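/- Let $E/\mathbb{Q}$ be an elliptic curve given by a (not necessarily minimal) Weierstrass equation $y^2+a_1xy+a_3y=x^3+a_2x^2+a_4x+a_6$ with $a_i\in\mathbb{Z}$, and let $P\in E(\mathbb{Q})$ be a point of infinite order. For a prime $p$ let $E_0(\mathbb{Q}_p)$ be the group of points of $E(\mathbb{Q}_p)$ whose reduction modulo $p$ (with respect to the given equation) is nonsingular, and for $i\ge 1$ let $E_i(\mathbb{Q}_p)=\{Q\in E_0(\mathbb{Q}_p): Q\equiv O \bmod p^i\}$, where $O=(0:1:0)$. Put $v_p(Q)=\sup\{i: Q\in E_i(\mathbb{Q}_p)\}$ if $Q\in E_1(\mathbb{Q}_p)$ and $v_p(Q)=0$ otherwise, and for $Q\in E_0(\mathbb{Q}_p)$ and $i\ge1$ let $\operatorname{ord}(Q\bmod p^i)$ be the order of the image of $Q$ in $E_0(\mathbb{Q}_p)/E_i(\mathbb{Q}_p)$. Let $\psi_n$ ($n\in\mathbb{Z}$) be the division polynomials of the given equation. For $n\ne0$ write $nP=(a_n/e_n^2,\,b_n/e_n^3)$ with integers $a_n,b_n,e_n$, $\gcd(a_nb_n,e_n)=1$ and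 $e_n>0$, and set $$\beta_0=0,\qquad \beta_n=\operatorname{sign}(\psi_n(P))\,\frac{e_n}{e_1}\quad(n\in\mathbb{Z}\setminus\{0\}).$$ Let $M=\operatorname{lcm}\{\operatorname{ord}(P+E_0(\mathbb{Q}_p)): p\text{ prime}\}$, where $\operatorname{ord}(P+E_0(\mathbb{Q}_p))$ is the order of the image of $P$ in the finite group $E(\mathbb{Q}_p)/E_0(\mathbb{Q}_p)$; that is, $M$ is the least positive integer such that $MP\in E_0(\mathbb{Q}_p)$ for all primes $p$. Then all $\beta_n$ are integers, and the following holds. Let $p$ be a prime and $k\ge1$ an integer, and let $$r(p^k)=M\cdot\operatorname{ord}\bigl(MP\bmod p^{\,k+v_p(MP)}\bigr),$$ $$\pi(p^k)=\begin{cases}(p-1)p^{k-1}r(p^k),&\text{if }p\ne2\text{ and }\left(\dfrac{\beta_{M+r(p^k)}\,\beta_{M-r(p^k)}}{p}\right)=1,\\[2mm] 2(p-1)p^{k-1}r(p^k),&\text{otherwise,}\end{cases}$$ where $\left(\frac{\cdot}{p}\right)$ is the Legendre symbol. Then $\pi(p^k)$ is a (finite) positive integer, and for all $m,n\in\mathbb{Z}$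 $$m\equiv n \bmod \pi(p^k)\ \Longrightarrow\ \beta_m\equiv\beta_n \bmod p^k,$$ i.e. the sequence $\beta_n\bmod p^k$ is periodic with period dividing $\pi(p^k)$. Consequently $\beta_n$ is periodic modulo every positive integer $N$: there is an integer $T\ge1$ such that $m\equiv n\bmod T$ implies $\beta_m\equiv\beta_n\bmod N$. -/

import Mathlib

/-- `OrderModulo S Q` is the order of the class of `Q` in the quotient by the subgroup with
underlying set `S`, i.e. the least `n ≥ 1` with `n • Q ∈ S` (and `0` if there is none). -/
noncomputable def OrderModulo {A : Type*} [AddCommGroup A] (S : Set A) (Q : A) : ℕ :=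
  sInf {n : ℕ | 0 < n ∧ n • Q ∈ S}

namespace WeierstrassCurve

/-! ### Elliptic curves over `ℚ_p` given by an integral Weierstrass equation -/

section Local

variable (W : WeierstrassCurve ℤ) (p : ℕ) [Fact p.Prime]

/-- The homogeneous coordinates `v = (X, Y, Z)` lie in `ℤ_p`, are not all divisible by `p`, and
represent the point `Q ∈ E(ℚ_p) ⊆ ℙ²(ℚ_p)`. Reducing such coordinates modulo `p ^ i` gives the
image of `Q` in `ℙ²(ℤ_p / p ^ i)`. -/
def IsPrimitiveRep : (W.baseChange ℚ_[p]).toAffine.Point → (Fin 3 → ℤ_[p]) → Prop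
  | .zero, v => IsUnit (v 1) ∧ v 0 = 0 ∧ v 2 = 0
  | .some x y _, v => (∃ j, IsUnit (v j)) ∧ v 2 ≠ 0 ∧
      (v 0 : ℚ_[p]) = x * (v 2 : ℚ_[p]) ∧ (v 1 : ℚ_[p]) = y * (v 2 : ℚ_[p])

/-- `E_0(ℚ_p)`: the points whose reduction modulo `p` is a nonsingular point of the reduced
(projective) Weierstrass curve over `𝔽_p`. -/
def nonsingularReduction : Set (W.baseChange ℚ_[p]).toAffine.Point :=
  {Q | ∃ v : Fin 3 → ℤ_[p], IsPrimitiveRep W p Q v ∧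
    (W.map (Int.castRingHom (ZMod p))).toProjective.Nonsingular
      (fun j => PadicInt.toZMod (v j))}

/-- `E_i(ℚ_p) = {Q ∈ E_0(ℚ_p) : Q ≡ O mod p ^ i}`, where `O = (0 : 1 : 0)`
(for `i = 0` the congruence is empty and this is `E_0(ℚ_p)`). -/
def padicFiltration (i : ℕ) : Set (W.baseChange ℚ_[p]).toAffine.Point :=
  {Q | Q ∈ nonsingularReduction W p ∧ ∃ v : Fin 3 → ℤ_[p], IsPrimitiveRep W p Q v ∧
    (p : ℤ_[p]) ^ i ∣ v 0 ∧ (p : ℤ_[p]) ^ i ∣ v 2}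

/-- `v_p(Q) = sup {i : Q ∈ E_i(ℚ_p)}` for `Q ∈ E_1(ℚ_p)`, and `v_p(Q) = 0` for `Q ∉ E_1(ℚ_p)`
(the supremum of `{0}` or of `∅`). The value at `Q = O`, where the supremum is infinite,
is meaningless. -/
noncomputable def pointVal (Q : (W.baseChange ℚ_[p]).toAffine.Point) : ℕ :=
  sSup {i : ℕ | Q ∈ padicFiltration W p i}

open scoped Classical in
/-- A rational point, seen in `E(ℚ_p)`. -/
noncomputable def toPadicPoint (P : (W.baseChange ℚ).toAffine.Point) :
    (W.baseChange ℚ_[p]).toAffine.Point :=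
  Affine.Point.baseChange (W' := W.toAffine) ℚ ℚ_[p] P

open scoped Classical in
/-- The order of the image of `P` in `E(ℚ_p) / E_0(ℚ_p)`. -/
noncomputable def componentOrder (P : (W.baseChange ℚ).toAffine.Point) : ℕ :=
  OrderModulo (nonsingularReduction W p) (toPadicPoint W p P)

open scoped Classical in
/-- `ord(Q mod p ^ i)`: the order of the image of `Q` in `E_0(ℚ_p) / E_i(ℚ_p)`,
for a rational point `Q` in `E_0(ℚ_p)`. -/
noncomputable def orderModPow (i : ℕ) (Q : (W.baseChange ℚ).toAffine.Point) : ℕ :=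
  OrderModulo (padicFiltration W p i) (toPadicPoint W p Q)

end Local

/-! ### The elliptic divisibility sequence of a rational point -/

section Global

variable (W : WeierstrassCurve ℤ)

/-- `e` is a denominator of `Q`: `Q = (a / e ^ 2, b / e ^ 3)` with integers `a`, `b`, `e > 0`
and `gcd(a b, e) = 1`. -/
def IsDenominator : (W.baseChange ℚ).toAffine.Point → ℕ → Prop
  | .zero, _ => False
  | .some x y _, e => 0 < e ∧ ∃ a b : ℤ, x = (a : ℚ) / (e : ℚ) ^ 2 ∧ y = (b : ℚ) / (e : ℚ) ^ 3 ∧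
      IsCoprime (a * b) (e : ℤ)

/-- The denominator of a rational point `Q ≠ O`: the unique `e` with `IsDenominator W Q e`. -/
noncomputable def denominator (Q : (W.baseChange ℚ).toAffine.Point) : ℕ :=
  sInf {e : ℕ | IsDenominator W Q e}

/-- The value `ψ_n(P)` of the `n`-th division polynomial at an affine rational point. -/
noncomputable def psiAt (n : ℤ) : (W.baseChange ℚ).toAffine.Point → ℚ
  | .zero => 0
  | .some x y _ => ((W.baseChange ℚ).ψ n).evalEval x y

/-- The sequence `β_n = sign(ψ_n(P)) e_n / e_1`, `β_0 = 0`, where `e_n` is the denominator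
of `n P`. -/
noncomputable def edsb (P : (W.baseChange ℚ).toAffine.Point) (n : ℤ) : ℚ :=
  if n = 0 then 0
  else ((SignType.sign (psiAt W n P) : SignType) : ℚ) *
    (denominator W (n • P) : ℚ) / (denominator W P : ℚ)

/-- `M(P) = lcm {ord(P + E_0(ℚ_p)) : p prime}`, the least common multiple being the least
positive integer that is divisible by all these orders. -/
noncomputable def goodMultiple (P : (W.baseChange ℚ).toAffine.Point) : ℕ :=
  sInf {m : ℕ | 0 < m ∧ ∀ (p : ℕ) [Fact p.Prime], componentOrder W p P ∣ m}

/-- `r(p ^ k) = M ord(M P mod p ^ (k + v_p(M P)))`. -/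
noncomputable def edsbRank (P : (W.baseChange ℚ).toAffine.Point) (p : ℕ) [Fact p.Prime]
    (k : ℕ) : ℕ :=
  goodMultiple W P *
    orderModPow W p (k + pointVal W p (toPadicPoint W p (goodMultiple W P • P)))
      (goodMultiple W P • P)

/-- `π(p ^ k)`, for the sequence of integers `β` attached to `P`. -/
noncomputable def edsbPeriod (P : (W.baseChange ℚ).toAffine.Point) (β : ℤ → ℤ)
    (p : ℕ) [Fact p.Prime] (k : ℕ) : ℕ :=
  if p ≠ 2 ∧ legendreSym p (β ((goodMultiple W P : ℤ) + (edsbRank W P p k : ℤ)) *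
      β ((goodMultiple W P : ℤ) - (edsbRank W P p k : ℤ))) = 1 then
    (p - 1) * p ^ (k - 1) * edsbRank W P p k
  else
    2 * (p - 1) * p ^ (k - 1) * edsbRank W P p k

end Global

end WeierstrassCurve

/-!
Write `x(nP) = a_n / e_n ^ 2` in lowest terms. The pair `{x(P + Q), x(P - Q)}` is given by integral
biquadratic forms in the homogeneous coordinates of `x(P)` and `x(Q)`, and when `Q` has nonsingular
reduction at every prime the values of these forms have no common factor. Hence
`|a_m e_n ^ 2 - a_n e_m ^ 2| = e_{n + m} e_{n - m}` whenever `mP` is everywhere of nonsingular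
reduction. The identity `ψ_{n + m} ψ_{n - m} = (x(mP) - x(nP)) ψ_n ^ 2 ψ_m ^ 2` supplies the signs:
`β_{n + m} β_{n - m} = a_m β_n ^ 2 - a_n β_m ^ 2`.

For `r = r(p ^ k)` the prime power `p ^ k` divides `β_r`, so that
`β_{n + r} β_{n - r} ≡ A β_n ^ 2` modulo `p ^ (2 * k)` with `A = a_r` prime to `p`. Along a
progression of difference `r` the quotients of consecutive terms are thus geometric with ratio `A`,
and `β_{n + t r} ≡ β_n c ^ t A ^ (t (t - 1) / 2)` for some unit `c`. If `t` is a multiple of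
`φ(p ^ k)`, then `c ^ t` is trivial. The power of `A` is trivial for `t = 2 φ(p ^ k)`, and already
for `t = φ(p ^ k)` when `p` is odd and `A` is a square modulo `p`, which is what the Legendre
symbol detects.
-/

namespace DenominatorSequence

open WeierstrassCurve

section AddSub

variable {R S : Type*} [CommRing R] [CommRing S] (W : WeierstrassCurve R)

/-- The coordinates of the unordered pair of the points `v` and `w` of the projective line, as a
point of the symmetric square of the line, which is a projective plane. -/
def symSq (v w : Fin 2 → R) : Fin 3 → R :=
  ![v 0 * w 0, v 0 * w 1 + v 1 * w 0, v 1 * w 1]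

lemma symSq_comm (v w : Fin 2 → R) : symSq v w = symSq w v := by
  simp only [symSq, mul_comm, add_comm]

/-- The map `{x(P), x(Q)} ↦ {x(P + Q), x(P - Q)}` in homogeneous coordinates. The diagonal value
`addSub W v v` encodes the duplication map, and over a field it vanishes exactly when `v` is
the `x`-coordinate of a singular point. -/
noncomputable def addSub (v w : Fin 2 → R) : Fin 3 → R :=
  fun i ↦ (W.addSubMap i).eval (symSq v w)

lemma addSub_zero (v w : Fin 2 → R) : addSub W v w 0 =
    (v 0 * w 0) ^ 2 - W.b₄ * (v 0 * w 0) * (v 1 * w 1) -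
      W.b₆ * (v 0 * w 1 + v 1 * w 0) * (v 1 * w 1) - W.b₈ * (v 1 * w 1) ^ 2 := by
  simp [addSub, addSubMap, symSq]

lemma addSub_one (v w : Fin 2 → R) : addSub W v w 1 =
    2 * (v 0 * w 1 + v 1 * w 0) * (v 0 * w 0) + W.b₂ * (v 0 * w 0) * (v 1 * w 1) +
      W.b₄ * (v 0 * w 1 + v 1 * w 0) * (v 1 * w 1) + W.b₆ * (v 1 * w 1) ^ 2 := by
  simp [addSub, addSubMap, symSq]

lemma addSub_two (v w : Fin 2 → R) : addSub W v w 2 = (v 0 * w 1 - v 1 * w 0) ^ 2 := by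
  simp [addSub, addSubMap, symSq]
  ring

lemma addSub_smul_smul (a b : R) (v w : Fin 2 → R) :
    addSub W (a • v) (b • w) = (a * b) ^ 2 • addSub W v w := by
  ext i
  fin_cases i
  · simp only [Fin.zero_eta, addSub_zero, Pi.smul_apply, smul_eq_mul]; ring
  · simp only [Fin.mk_one, addSub_one, Pi.smul_apply, smul_eq_mul]; ring
  · simp only [Fin.reduceFinMk, addSub_two, Pi.smul_apply, smul_eq_mul]; ring

lemma addSub_map (f : R →+* S) (v w : Fin 2 → R) :
    addSub (W.map f) (f ∘ v) (f ∘ w) = f ∘ addSub W v w := by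
  ext i
  fin_cases i
  · simp [addSub_zero]
  · simp [addSub_one, map_ofNat]
  · simp [addSub_two]

/-- A Bézout relation between the two duplication forms, whose resultant is `Δ ^ 2`. -/
lemma Δ_mul_pow_eq (v : Fin 2 → R) : W.Δ * v 1 ^ 7 =
    addSub W v v 1 * (v 0 * (-(W.b₂ * v 1 + 12 * v 0) ^ 2 +
        32 * (W.b₄ * v 1 ^ 2 + W.b₂ * v 0 * v 1 + 6 * v 0 ^ 2)) +
      (W.b₂ * v 1 + 12 * v 0) * (W.b₄ * v 1 ^ 2 + W.b₂ * v 0 * v 1 + 6 * v 0 ^ 2) -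
      27 * (4 * v 0 ^ 3 + W.b₂ * v 0 ^ 2 * v 1 + 2 * W.b₄ * v 0 * v 1 ^ 2 + W.b₆ * v 1 ^ 3)) -
    addSub W v v 0 * (v 1 * (-(W.b₂ * v 1 + 12 * v 0) ^ 2 +
        32 * (W.b₄ * v 1 ^ 2 + W.b₂ * v 0 * v 1 + 6 * v 0 ^ 2))) := by
  have h := W.b_relation
  simp only [addSub_zero, addSub_one, Δ]
  grind

end AddSub

section Field

variable {K : Type*} [Field K] (W : WeierstrassCurve K)

lemma exists_eq_smul_of_mul_eq_mul {v w : Fin 2 → K} (hv : v ≠ 0) (h : v 0 * w 1 = v 1 * w 0) :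
    ∃ u : K, w = u • v := by
  by_cases h₀ : v 0 = 0
  · have h₁ : v 1 ≠ 0 := fun h₁ ↦ hv (by ext i; fin_cases i <;> assumption)
    refine ⟨w 1 / v 1, funext fun i ↦ ?_⟩
    fin_cases i
    · have : w 0 = 0 := by simpa [h₀, h₁] using h
      simp [h₀, this]
    · simp [h₁]
  · refine ⟨w 0 / v 0, funext fun i ↦ ?_⟩
    fin_cases i
    · simp [h₀]
    · simp only [Fin.mk_one, Pi.smul_apply, smul_eq_mul]
      field_simp
      linear_combination h

lemma addSub_self_eq_zero_of_addSub_eq_zero {v w : Fin 2 → K} (hv : v ≠ 0)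
    (h : addSub W v w = 0) : addSub W w w = 0 := by
  have h₂ : (v 0 * w 1 - v 1 * w 0) ^ 2 = 0 := by rw [← addSub_two W, h, Pi.zero_apply]
  obtain ⟨u, rfl⟩ := exists_eq_smul_of_mul_eq_mul hv
    (sub_eq_zero.1 (pow_eq_zero_iff two_ne_zero |>.1 h₂))
  have hu : u ^ 2 • addSub W v v = 0 := by
    simpa [h] using (addSub_smul_smul W 1 u v v).symm
  rw [addSub_smul_smul, mul_pow, mul_smul, hu, smul_zero]

lemma apply_one_ne_zero_of_addSub_self_eq_zero {v : Fin 2 → K} (hv : v ≠ 0)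
    (h : addSub W v v = 0) : v 1 ≠ 0 := by
  refine fun h₁ ↦ hv (funext fun i ↦ ?_)
  have h₀ := congrFun h 0
  fin_cases i
  · simpa [addSub_zero, h₁] using h₀
  · exact h₁

/-- The Taylor expansion at the singular point of the quadratic form with roots `x(P ± Q)`. -/
lemma addSub_root_eq_sq {x : K} (hx : addSub W ![x, 1] ![x, 1] = 0) (v w : Fin 2 → K) :
    addSub W v w 2 * x ^ 2 - addSub W v w 1 * x + addSub W v w 0 =
      ((v 0 - x * v 1) * (w 0 - x * w 1)) ^ 2 := by
  have hnum := congrFun hx 0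
  have hden := congrFun hx 1
  simp only [addSub_zero, addSub_one, Matrix.cons_val_zero, Matrix.cons_val_one, mul_one,
    one_mul, Pi.zero_apply, one_pow] at hnum hden
  have hb : W.b₄ + W.b₂ * x + 6 * x ^ 2 = 0 := by
    have h := W.b_relation
    refine pow_eq_zero_iff two_ne_zero |>.1 ?_
    linear_combination (8 * x + W.b₂) * hden + 4 * hnum + h
  simp only [addSub_zero, addSub_one, addSub_two]
  linear_combination (-(v 0 - x * v 1) * (w 0 - x * w 1) * v 1 * w 1) * hb -
    (((v 0 - x * v 1) * w 1 + (w 0 - x * w 1) * v 1) * v 1 * w 1 + x * v 1 ^ 2 * w 1 ^ 2) * hden +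
    v 1 ^ 2 * w 1 ^ 2 * hnum

/-- This makes nonsingular reduction stable under addition: `v`, `w` and `r` stand for `x(P)`,
`x(Q)` and one of `x(P ± Q)`. -/
lemma addSub_self_eq_zero_or_of_smul_symSq {c : K} {r s v w : Fin 2 → K} (hr : r ≠ 0)
    (h : addSub W v w = c • symSq r s) (h₀ : addSub W r r = 0) :
    addSub W v v = 0 ∨ addSub W w w = 0 := by
  have hr₁ := apply_one_ne_zero_of_addSub_self_eq_zero W hr h₀
  obtain ⟨x, hx⟩ : ∃ x, r 0 = r 1 * x := ⟨r 0 / r 1, (mul_div_cancel₀ _ hr₁).symm⟩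
  have hr' : r = r 1 • ![x, 1] := by
    ext i
    fin_cases i
    · simpa using hx
    · simp
  have hsing : addSub W ![x, 1] ![x, 1] = 0 := by
    rw [hr', addSub_smul_smul] at h₀
    exact (smul_eq_zero.1 h₀).resolve_left (pow_ne_zero _ (mul_ne_zero hr₁ hr₁))
  have hroot : ((v 0 - x * v 1) * (w 0 - x * w 1)) ^ 2 = 0 := by
    rw [← addSub_root_eq_sq W hsing, h]
    simp [symSq, hx]
    ring
  have key (t : Fin 2 → K) (ht : t 0 - x * t 1 = 0) : addSub W t t = 0 := by
    have : t = t 1 • ![x, 1] := by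
      ext i
      fin_cases i
      · simpa [mul_comm, sub_eq_zero] using ht
      · simp
    rw [this, addSub_smul_smul, hsing, smul_zero]
  exact (mul_eq_zero.1 (pow_eq_zero_iff two_ne_zero |>.1 hroot)).imp (key v) (key w)

end Field

section Point

lemma addSub_self_one_eq_sq {R : Type*} [CommRing R] {W : Affine R} {x y : R}
    (h : W.Equation x y) : addSub W ![x, 1] ![x, 1] 1 = (y - W.negY x y) ^ 2 := by
  rw [Affine.equation_iff] at h
  simp only [addSub_one, Affine.negY, b₂, b₄, b₆, Matrix.cons_val_zero, Matrix.cons_val_one]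
  linear_combination (-4) * h

lemma addSub_self_zero_eq_of_equation {R : Type*} [CommRing R] {W : Affine R} {x y : R}
    (h : W.Equation x y) : addSub W ![x, 1] ![x, 1] 0 =
      (W.a₁ * y - (3 * x ^ 2 + 2 * W.a₂ * x + W.a₄)) ^ 2 -
        W.a₁ * (W.a₁ * y - (3 * x ^ 2 + 2 * W.a₂ * x + W.a₄)) * (y - W.negY x y) -
        (W.a₂ + 2 * x) * (y - W.negY x y) ^ 2 := by
  rw [Affine.equation_iff] at h
  simp only [addSub_zero, Affine.negY, b₄, b₆, b₈, Matrix.cons_val_zero, Matrix.cons_val_one]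
  linear_combination (W.a₁ ^ 2 + 4 * W.a₂ + 8 * x) * h

variable {F : Type*} [Field F]

lemma nonsingular_iff_addSub_self_ne_zero {W : Affine F} {x y : F} (h : W.Equation x y) :
    W.Nonsingular x y ↔ addSub W ![x, 1] ![x, 1] ≠ 0 := by
  rw [Affine.nonsingular_iff, and_iff_right h, ← not_and_or, not_iff_not,
    ← sub_eq_zero (a := W.a₁ * y), ← sub_eq_zero (a := y)]
  have h₀ := addSub_self_zero_eq_of_equation h
  have h₁ := addSub_self_one_eq_sq h
  constructor
  · rintro ⟨e₁, e₂⟩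
    rw [Affine.negY, e₂] at h₀ h₁
    ext i
    fin_cases i
    · simpa [e₁] using h₀
    · simpa using h₁
    · simp [addSub_two]
  · intro hs
    rw [hs, Pi.zero_apply] at h₀ h₁
    have e₂ : y - W.negY x y = 0 := pow_eq_zero_iff two_ne_zero |>.1 h₁.symm
    rw [e₂] at h₀
    exact ⟨pow_eq_zero_iff two_ne_zero |>.1 (by linear_combination -h₀), e₂⟩

variable [DecidableEq F] {W : Affine F}

lemma exists_addSub_xRep_self (P : W.Point) :
    ∃ c : F, addSub W P.xRep P.xRep = c • symSq (P + P).xRep ![1, 0] := by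
  rcases P with _ | ⟨x, y, h⟩
  · refine ⟨1, funext fun i ↦ ?_⟩
    fin_cases i <;> simp [← Affine.Point.zero_def, addSub_zero, addSub_one, addSub_two, symSq]
  have h₀ := addSub_self_zero_eq_of_equation h.1
  have h₁ := addSub_self_one_eq_sq h.1
  by_cases hy : y = W.negY x y
  · refine ⟨addSub W ![x, 1] ![x, 1] 0, funext fun i ↦ ?_⟩
    rw [sub_eq_zero.2 hy, zero_pow two_ne_zero] at h₁
    rw [Affine.Point.add_self_of_Y_eq hy]
    fin_cases i
    · simp [symSq]
    · simpa [symSq] using h₁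
    · simp [symSq, addSub_two]
  · refine ⟨addSub W ![x, 1] ![x, 1] 1, funext fun i ↦ ?_⟩
    have hη : y - W.negY x y ≠ 0 := sub_ne_zero.2 hy
    rw [Affine.Point.add_self_of_Y_ne hy]
    simp only [Affine.Point.xRep_some, Affine.slope_of_Y_ne rfl hy, Affine.addX]
    fin_cases i
    · simp only [Fin.zero_eta, h₀, h₁, symSq, Pi.smul_apply, smul_eq_mul, Matrix.cons_val_zero,
        Matrix.cons_val_one]
      field_simp
      ring
    · simp [symSq]
    · simp [symSq, addSub_two]

lemma addSub_xRep_of_X_ne {x₁ y₁ x₂ y₂ : F} (h₁ : W.Nonsingular x₁ y₁)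
    (h₂ : W.Nonsingular x₂ y₂) (hx : x₁ ≠ x₂) :
    addSub W ![x₁, 1] ![x₂, 1] = (x₁ - x₂) ^ 2 •
      symSq (Affine.Point.some x₁ y₁ h₁ + .some x₂ y₂ h₂).xRep
        (Affine.Point.some x₁ y₁ h₁ - .some x₂ y₂ h₂).xRep := by
  have hd : x₁ - x₂ ≠ 0 := sub_ne_zero.2 hx
  have e₁ := (Affine.equation_iff ..).1 h₁.1
  have e₂ := (Affine.equation_iff ..).1 h₂.1
  rw [sub_eq_add_neg (Affine.Point.some ..), Affine.Point.neg_some, Affine.Point.add_of_X_ne hx,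
    Affine.Point.add_of_X_ne hx]
  simp only [Affine.Point.xRep_some, Affine.slope_of_X_ne hx]
  ext i
  fin_cases i
  · have h₄ : W.a₄ = (y₁ ^ 2 + W.a₁ * x₁ * y₁ + W.a₃ * y₁ - x₁ ^ 3 - W.a₂ * x₁ ^ 2 -
        (y₂ ^ 2 + W.a₁ * x₂ * y₂ + W.a₃ * y₂ - x₂ ^ 3 - W.a₂ * x₂ ^ 2)) / (x₁ - x₂) := by
      field_simp
      linear_combination e₂ - e₁
    have h₆ : W.a₆ = y₁ ^ 2 + W.a₁ * x₁ * y₁ + W.a₃ * y₁ -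
        (x₁ ^ 3 + W.a₂ * x₁ ^ 2 + W.a₄ * x₁) := by linear_combination -e₁
    simp only [Fin.zero_eta, addSub_zero, symSq, Affine.addX, Affine.negY, b₄, b₆, b₈,
      Pi.smul_apply, smul_eq_mul, Matrix.cons_val_zero, Matrix.cons_val_one]
    rw [h₆, h₄]
    field_simp
    ring
  · simp only [Fin.mk_one, addSub_one, symSq, Affine.addX, Affine.negY, b₂, b₄, b₆,
      Pi.smul_apply, smul_eq_mul, Matrix.cons_val_zero, Matrix.cons_val_one]
    field_simp
    linear_combination (-2) * e₁ + (-2) * e₂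
  · simp [addSub_two, symSq]

theorem exists_addSub_xRep (P Q : W.Point) :
    ∃ c : F, addSub W P.xRep Q.xRep = c • symSq (P + Q).xRep (P - Q).xRep := by
  rcases P with _ | ⟨x₁, y₁, h₁⟩
  · refine ⟨1, funext fun i ↦ ?_⟩
    fin_cases i <;> simp [← Affine.Point.zero_def, addSub_zero, addSub_one, addSub_two, symSq] <;>
      ring
  rcases Q with _ | ⟨x₂, y₂, h₂⟩
  · refine ⟨1, funext fun i ↦ ?_⟩
    fin_cases i <;> simp [← Affine.Point.zero_def, addSub_zero, addSub_one, addSub_two, symSq] <;>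
      ring
  by_cases hx : x₁ = x₂
  · obtain ⟨c, hc⟩ := exists_addSub_xRep_self (.some x₂ y₂ h₂ : W.Point)
    refine ⟨c, ?_⟩
    rcases Affine.Point.X_eq_iff.1 hx with h | h
    · rw [h, sub_self, hc, Affine.Point.xRep_zero]
    · rw [h, sub_eq_add_neg, ← neg_add, neg_add_cancel, Affine.Point.xRep_neg,
        Affine.Point.xRep_neg, hc, Affine.Point.xRep_zero, symSq_comm]
  · exact ⟨(x₁ - x₂) ^ 2, addSub_xRep_of_X_ne h₁ h₂ hx⟩

end Point

section Denominator

lemma natAbs_eq_sq_and_natAbs_eq_cube {B U r d D : ℤ} (hd : d ≠ 0) (hU : IsCoprime d U)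
    (hB : IsCoprime D B) (h : B ^ 2 * d ^ 3 + r * D * d ^ 2 = D ^ 2 * U) :
    ∃ e : ℕ, d.natAbs = e ^ 2 ∧ D.natAbs = e ^ 3 := by
  obtain ⟨g, rfl⟩ : d ∣ D := by
    have : d ^ 2 ∣ D ^ 2 * U := ⟨B ^ 2 * d + r * D, by rw [← h]; ring⟩
    exact (Int.pow_dvd_pow_iff two_ne_zero).1 (hU.pow_left.dvd_of_dvd_mul_right this)
  have hg : IsCoprime g (B ^ 2) := hB.of_mul_left_right.pow_right
  have h₁ : B ^ 2 * d + r * g * d = g ^ 2 * U :=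
    mul_left_cancel₀ (pow_ne_zero 2 hd) (by linear_combination h)
  obtain ⟨f, rfl⟩ : g ∣ d :=
    hg.dvd_of_dvd_mul_left ⟨g * U - r * d, by linear_combination h₁⟩
  have h₂ : B ^ 2 * f + r * g * f = g * U :=
    mul_left_cancel₀ (left_ne_zero_of_mul hd) (by linear_combination h₁)
  have hgf : g ∣ f := hg.dvd_of_dvd_mul_left ⟨U - r * f, by linear_combination h₂⟩
  have hfg : f ∣ g :=
    hU.of_mul_left_right.dvd_of_dvd_mul_right ⟨B ^ 2 + r * g, by linear_combination -h₂⟩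
  have habs : f.natAbs = g.natAbs :=
    Nat.dvd_antisymm (Int.natAbs_dvd_natAbs.2 hfg) (Int.natAbs_dvd_natAbs.2 hgf)
  exact ⟨g.natAbs, by rw [Int.natAbs_mul, habs, sq], by simp only [Int.natAbs_mul, habs]; ring⟩

variable (W : WeierstrassCurve ℤ)

lemma equation_num_den {x y : ℚ} (h : (W.baseChange ℚ).toAffine.Equation x y) :
    y.num ^ 2 * (x.den : ℤ) ^ 3 + (W.a₁ * x.num * y.num + W.a₃ * y.num * x.den) * y.den *
        x.den ^ 2 =
      (y.den : ℤ) ^ 2 * (x.num ^ 3 + W.a₂ * x.num ^ 2 * x.den + W.a₄ * x.num * x.den ^ 2 +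
        W.a₆ * x.den ^ 3) := by
  have hx : (x.den : ℚ) ≠ 0 := by exact_mod_cast x.den_nz
  have hy : (y.den : ℚ) ≠ 0 := by exact_mod_cast y.den_nz
  rw [Affine.equation_iff, ← Rat.num_div_den x, ← Rat.num_div_den y] at h
  simp only [baseChange, map_a₁, map_a₂, map_a₃, map_a₄, map_a₆, algebraMap_int_eq,
    eq_intCast] at h
  field_simp at h
  rw [← Int.cast_inj (α := ℚ)]
  push_cast
  linear_combination h

lemma exists_den_eq_sq_and_den_eq_cube {x y : ℚ} (h : (W.baseChange ℚ).toAffine.Equation x y) :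
    ∃ e : ℕ, x.den = e ^ 2 ∧ y.den = e ^ 3 := by
  have hx : IsCoprime (x.den : ℤ) x.num := (Rat.isCoprime_num_den x).symm
  have hU : IsCoprime (x.den : ℤ) (x.num ^ 3 + W.a₂ * x.num ^ 2 * x.den +
      W.a₄ * x.num * x.den ^ 2 + W.a₆ * x.den ^ 3) := by
    have : x.num ^ 3 + W.a₂ * x.num ^ 2 * x.den + W.a₄ * x.num * x.den ^ 2 + W.a₆ * x.den ^ 3 =
        x.num ^ 3 + x.den * (W.a₂ * x.num ^ 2 + W.a₄ * x.num * x.den + W.a₆ * x.den ^ 2) := by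
      ring
    rw [this]
    exact hx.pow_right.add_mul_left_right _
  simpa using natAbs_eq_sq_and_natAbs_eq_cube (by exact_mod_cast x.den_nz) hU
    (Rat.isCoprime_num_den y).symm (equation_num_den W h)

end Denominator

section RationalPoint

/-- The rational points of the generic fibre of an integral Weierstrass equation. -/
abbrev RatPoint (W : WeierstrassCurve ℤ) : Type :=
  (W.baseChange ℚ).toAffine.Point

variable {W : WeierstrassCurve ℤ}

/-- The integer `a` in `Q = (a / e ^ 2, b / e ^ 3)`, with value `1` at infinity. -/
def xNum : RatPoint W → ℤ
  | .zero => 1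
  | .some x _ _ => x.num

/-- The integer `b` in `Q = (a / e ^ 2, b / e ^ 3)`, with value `1` at infinity. -/
def yNum : RatPoint W → ℤ
  | .zero => 1
  | .some _ y _ => y.num

/-- The positive integer `e` in `Q = (a / e ^ 2, b / e ^ 3)`, with value `0` at infinity. -/
def sqrtDen : RatPoint W → ℕ
  | .zero => 0
  | .some x _ _ => x.den.sqrt

/-- The coprime homogeneous coordinates `(a : e ^ 2)` of the `x`-coordinate of a point. -/
def xCoord (Q : RatPoint W) : Fin 2 → ℤ :=
  ![xNum Q, (sqrtDen Q : ℤ) ^ 2]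

lemma xNum_zero : xNum (0 : RatPoint W) = 1 := rfl

lemma sqrtDen_zero : sqrtDen (0 : RatPoint W) = 0 := rfl

lemma sqrtDen_neg (Q : RatPoint W) : sqrtDen (-Q) = sqrtDen Q := by
  cases Q <;> rfl

lemma sqrtDen_some_pow {x y : ℚ} (h : (W.baseChange ℚ).toAffine.Nonsingular x y) :
    sqrtDen (.some x y h : RatPoint W) ^ 2 = x.den ∧
      sqrtDen (.some x y h : RatPoint W) ^ 3 = y.den := by
  obtain ⟨e, hx, hy⟩ := exists_den_eq_sq_and_den_eq_cube W h.1
  simp [sqrtDen, hx, hy]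

lemma eq_xNum_div {x y : ℚ} (h : (W.baseChange ℚ).toAffine.Nonsingular x y) :
    x = xNum (.some x y h : RatPoint W) / (sqrtDen (.some x y h : RatPoint W) : ℚ) ^ 2 := by
  conv_lhs => rw [← Rat.num_div_den x, ← (sqrtDen_some_pow h).1, Nat.cast_pow]
  rfl

lemma eq_yNum_div {x y : ℚ} (h : (W.baseChange ℚ).toAffine.Nonsingular x y) :
    y = yNum (.some x y h : RatPoint W) / (sqrtDen (.some x y h : RatPoint W) : ℚ) ^ 3 := by
  conv_lhs => rw [← Rat.num_div_den y, ← (sqrtDen_some_pow h).2, Nat.cast_pow]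
  rfl

lemma sqrtDen_pos {Q : RatPoint W} (hQ : Q ≠ 0) : 0 < sqrtDen Q := by
  rcases Q with _ | ⟨x, y, h⟩
  · exact (hQ rfl).elim
  · exact Nat.pos_of_ne_zero (left_ne_zero_of_mul
      (pow_two (sqrtDen (.some x y h : RatPoint W)) ▸ (sqrtDen_some_pow h).1 ▸ x.den_nz))

lemma isCoprime_xNum_sqrtDen (Q : RatPoint W) : IsCoprime (xNum Q) (sqrtDen Q : ℤ) := by
  rcases Q with _ | ⟨x, y, h⟩
  · exact isCoprime_one_left
  · have hx := Rat.isCoprime_num_den x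
    rw [← (sqrtDen_some_pow h).1, Nat.cast_pow] at hx
    exact (IsCoprime.pow_right_iff two_pos).1 hx

lemma isCoprime_yNum_sqrtDen (Q : RatPoint W) : IsCoprime (yNum Q) (sqrtDen Q : ℤ) := by
  rcases Q with _ | ⟨x, y, h⟩
  · exact isCoprime_one_left
  · have hy := Rat.isCoprime_num_den y
    rw [← (sqrtDen_some_pow h).2, Nat.cast_pow] at hy
    exact (IsCoprime.pow_right_iff three_pos).1 hy

lemma yNum_equation (Q : RatPoint W) :
    yNum Q ^ 2 + W.a₁ * xNum Q * yNum Q * sqrtDen Q + W.a₃ * yNum Q * (sqrtDen Q : ℤ) ^ 3 =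
      xNum Q ^ 3 + W.a₂ * xNum Q ^ 2 * (sqrtDen Q : ℤ) ^ 2 +
        W.a₄ * xNum Q * (sqrtDen Q : ℤ) ^ 4 + W.a₆ * (sqrtDen Q : ℤ) ^ 6 := by
  rcases Q with _ | ⟨x, y, h⟩
  · simp [xNum, yNum, sqrtDen]
  have he := equation_num_den W h.1
  have hpos : (sqrtDen (.some x y h : RatPoint W) : ℤ) ≠ 0 := by
    exact_mod_cast (sqrtDen_pos (Affine.Point.some_ne_zero h)).ne'
  rw [← (sqrtDen_some_pow h).1, ← (sqrtDen_some_pow h).2] at he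
  push_cast at he
  refine mul_left_cancel₀ (pow_ne_zero 6 hpos) ?_
  simp only [xNum, yNum]
  linear_combination he

lemma isDenominator_iff {Q : RatPoint W} (hQ : Q ≠ 0) (e : ℕ) :
    IsDenominator W Q e ↔ e = sqrtDen Q := by
  rcases Q with _ | ⟨x, y, h⟩
  · exact (hQ rfl).elim
  constructor
  · rintro ⟨he, a, b, hx, -, hc⟩
    have hden := Rat.den_div_eq_of_coprime (a := a) (b := (e : ℤ) ^ 2) (by positivity)
      (Int.isCoprime_iff_gcd_eq_one.1 hc.of_mul_left_left.pow_right)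
    have : x.den = e ^ 2 := by
      rw [hx]
      exact_mod_cast hden
    simp [sqrtDen, this]
  · rintro rfl
    exact ⟨sqrtDen_pos hQ, _, _, eq_xNum_div h, eq_yNum_div h,
      (isCoprime_xNum_sqrtDen _).mul_left (isCoprime_yNum_sqrtDen _)⟩

lemma denominator_eq_sqrtDen {Q : RatPoint W} (hQ : Q ≠ 0) :
    denominator W Q = sqrtDen Q := by
  simp [denominator, isDenominator_iff hQ]

lemma exists_xCoord_eq_smul_xRep (Q : RatPoint W) :
    ∃ t : ℚ, t ≠ 0 ∧ algebraMap ℤ ℚ ∘ xCoord Q = t • Q.xRep := by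
  rcases Q with _ | ⟨x, y, h⟩
  · refine ⟨1, one_ne_zero, funext fun i ↦ ?_⟩
    fin_cases i <;> simp [xCoord, xNum, sqrtDen, ← Affine.Point.zero_def]
  · have hpos := sqrtDen_pos (Affine.Point.some_ne_zero h)
    refine ⟨(sqrtDen (.some x y h : RatPoint W) : ℚ) ^ 2, by positivity, funext fun i ↦ ?_⟩
    fin_cases i
    · have := (eq_div_iff (by positivity)).1 (eq_xNum_div h)
      simpa [xCoord, mul_comm] using this.symm
    · simp [xCoord]

lemma exists_not_dvd_xCoord {p : ℤ} (hp : Prime p) (Q : RatPoint W) :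
    ∃ i, ¬ p ∣ xCoord Q i := by
  by_contra! h
  exact hp.not_isUnit ((isCoprime_xNum_sqrtDen Q).isUnit_of_dvd' (h 0)
    (hp.dvd_of_dvd_pow (h 1)))

end RationalPoint

section IntegralAddSub

lemma exists_not_dvd_symSq {R : Type*} [CommRing R] {p : R} (hp : Prime p) {v w : Fin 2 → R}
    (hv : ∃ i, ¬ p ∣ v i) (hw : ∃ i, ¬ p ∣ w i) : ∃ i, ¬ p ∣ symSq v w i := by
  by_contra! h
  have h₀ : p ∣ v 0 * w 0 := h 0
  have h₁ : p ∣ v 0 * w 1 + v 1 * w 0 := h 1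
  have h₂ : p ∣ v 1 * w 1 := h 2
  simp only [Fin.exists_fin_two] at hv hw
  rcases hp.dvd_or_dvd h₀ with hv₀ | hw₀
  · rw [dvd_add_right (hv₀.mul_right _)] at h₁
    have := hp.dvd_or_dvd h₁
    have := hp.dvd_or_dvd h₂
    tauto
  · rw [dvd_add_left (hw₀.mul_left _)] at h₁
    have := hp.dvd_or_dvd h₁
    have := hp.dvd_or_dvd h₂
    tauto

lemma exists_int_eq_smul_of_rat {ι : Type*} {c : ℚ} {u f : ι → ℤ}
    (hu : ∀ p : ℤ, Prime p → ∃ i, ¬ p ∣ u i)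
    (h : algebraMap ℤ ℚ ∘ f = c • (algebraMap ℤ ℚ ∘ u)) : ∃ g : ℤ, f = g • u := by
  have hc₀ : (c.den : ℚ) ≠ 0 := by exact_mod_cast c.den_nz
  have key (i : ι) : (c.den : ℤ) * f i = c.num * u i := by
    have hi : (f i : ℚ) = c * u i := congrFun h i
    rw [← Rat.num_div_den c] at hi
    field_simp at hi
    rw [mul_comm]
    exact_mod_cast hi
  have hc : c.den = 1 := by
    by_contra hne
    obtain ⟨p, hp, hpd⟩ := Nat.exists_prime_and_dvd hne
    obtain ⟨i, hi⟩ := hu p (Nat.prime_iff_prime_int.1 hp)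
    have hdvd : (c.den : ℤ) ∣ u i :=
      (Rat.isCoprime_num_den c).symm.dvd_of_dvd_mul_left ⟨f i, (key i).symm⟩
    exact hi ((Int.natCast_dvd_natCast.2 hpd).trans hdvd)
  exact ⟨c.num, funext fun i ↦ by simpa [hc] using key i⟩

lemma symSq_smul_smul {R : Type*} [CommRing R] (a b : R) (v w : Fin 2 → R) :
    symSq (a • v) (b • w) = (a * b) • symSq v w := by
  ext i
  fin_cases i <;> simp [symSq] <;> ring

lemma symSq_map {R S : Type*} [CommRing R] [CommRing S] (f : R →+* S) (v w : Fin 2 → R) :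
    symSq (f ∘ v) (f ∘ w) = f ∘ symSq v w := by
  ext i
  fin_cases i <;> simp [symSq]

variable {W : WeierstrassCurve ℤ}

theorem exists_addSub_xCoord (P Q : RatPoint W) : ∃ g : ℤ,
    addSub W (xCoord P) (xCoord Q) = g • symSq (xCoord (P + Q)) (xCoord (P - Q)) := by
  obtain ⟨c, hc⟩ := exists_addSub_xRep P Q
  obtain ⟨t₁, -, h₁⟩ := exists_xCoord_eq_smul_xRep P
  obtain ⟨t₂, -, h₂⟩ := exists_xCoord_eq_smul_xRep Q
  obtain ⟨t₃, ht₃, h₃⟩ := exists_xCoord_eq_smul_xRep (P + Q)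
  obtain ⟨t₄, ht₄, h₄⟩ := exists_xCoord_eq_smul_xRep (P - Q)
  refine exists_int_eq_smul_of_rat (c := (t₁ * t₂) ^ 2 * c / (t₃ * t₄))
    (fun p hp ↦ exists_not_dvd_symSq hp (exists_not_dvd_xCoord hp _)
      (exists_not_dvd_xCoord hp _)) ?_
  rw [← symSq_map, ← addSub_map, h₁, h₂, h₃, h₄, addSub_smul_smul, symSq_smul_smul, smul_smul,
    div_mul_cancel₀ _ (mul_ne_zero ht₃ ht₄), mul_smul]
  exact congrArg _ hc

end IntegralAddSub

section GoodReduction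

lemma pow_dvd_right_of_not_pow_dvd_left {p x y : ℤ} (hp : Prime p) {a b : ℕ}
    (h : p ^ (a + b) ∣ x * y) (hx : ¬ p ^ (a + 1) ∣ x) : p ^ b ∣ y := by
  rw [pow_dvd_iff_le_emultiplicity] at *
  rw [emultiplicity_mul hp] at h
  rw [not_le] at hx
  generalize emultiplicity p x = u at *
  generalize emultiplicity p y = v at *
  lift u to ℕ using hx.ne_top
  by_cases hv : v = ⊤
  · simp [hv]
  lift v to ℕ using hv
  norm_cast at *
  omega

lemma pow_dvd_or_pow_dvd_of_pow_two_mul_dvd_mul {p x y : ℤ} (hp : Prime p) {i : ℕ}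
    (h : p ^ (2 * i) ∣ x * y) : p ^ i ∣ x ∨ p ^ i ∣ y :=
  or_iff_not_imp_left.2 fun hx ↦ pow_dvd_right_of_not_pow_dvd_left hp (two_mul i ▸ h)
    fun hx' ↦ hx ((pow_dvd_pow p i.le_succ).trans hx')

lemma forall_dvd_iff_castRingHom_comp_eq_zero {ι : Type*} {n : ℕ} {u : ι → ℤ} :
    (∀ i, (n : ℤ) ∣ u i) ↔ Int.castRingHom (ZMod n) ∘ u = 0 := by
  simp [funext_iff, ZMod.intCast_zmod_eq_zero_iff_dvd]

lemma dvd_addSub_one {R : Type*} [CommRing R] {W : WeierstrassCurve R} {n : R} {v w : Fin 2 → R}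
    (hv : n ∣ v 1) (hw : n ∣ w 1) : n ∣ addSub W v w 1 := by
  rw [addSub_one]
  obtain ⟨k, hk⟩ := hv
  obtain ⟨l, hl⟩ := hw
  rw [hk, hl]
  exact ⟨2 * (v 0 * l + k * w 0) * (v 0 * w 0) + W.b₂ * (v 0 * w 0) * (n * k * l) +
    W.b₄ * (v 0 * l + k * w 0) * (n * k * (n * l)) + W.b₆ * n ^ 3 * (k * l) ^ 2, by ring⟩

lemma sq_dvd_addSub_two {R : Type*} [CommRing R] {W : WeierstrassCurve R} {n : R}
    {v w : Fin 2 → R} (hv : n ∣ v 1) (hw : n ∣ w 1) : n ^ 2 ∣ addSub W v w 2 := by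
  rw [addSub_two]
  exact pow_dvd_pow_of_dvd (dvd_sub (hw.mul_left _) (hv.mul_right _)) 2

variable {W : WeierstrassCurve ℤ}

/-- The point `Q` has nonsingular reduction modulo `p` with respect to the equation `W`:
otherwise the duplication forms `addSub W v v` would vanish at the reduction of `x(Q)`. -/
def IsGoodAt (p : ℕ) (Q : RatPoint W) : Prop :=
  ∃ i, ¬ (p : ℤ) ∣ addSub W (xCoord Q) (xCoord Q) i

variable {p : ℕ} {P Q : RatPoint W}

lemma symSq_xCoord_two (P Q : RatPoint W) :
    symSq (xCoord P) (xCoord Q) 2 = (sqrtDen P * sqrtDen Q : ℤ) ^ 2 :=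
  (mul_pow _ _ _).symm

lemma isGoodAt_iff : IsGoodAt p Q ↔ addSub (W.map (Int.castRingHom (ZMod p)))
    (Int.castRingHom (ZMod p) ∘ xCoord Q) (Int.castRingHom (ZMod p) ∘ xCoord Q) ≠ 0 := by
  rw [addSub_map, Ne, ← forall_dvd_iff_castRingHom_comp_eq_zero, not_forall, IsGoodAt]

lemma castRingHom_comp_xCoord_ne_zero (hp : p.Prime) (Q : RatPoint W) :
    Int.castRingHom (ZMod p) ∘ xCoord Q ≠ 0 := by
  rw [Ne, ← forall_dvd_iff_castRingHom_comp_eq_zero, not_forall]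
  exact exists_not_dvd_xCoord (Nat.prime_iff_prime_int.1 hp) Q

lemma not_dvd_xNum (hp : p.Prime) (h : (p : ℤ) ∣ sqrtDen Q) : ¬ (p : ℤ) ∣ xNum Q := fun h' ↦
  (Nat.prime_iff_prime_int.1 hp).not_isUnit ((isCoprime_xNum_sqrtDen Q).isUnit_of_dvd' h' h)

lemma isGoodAt_of_dvd_sqrtDen (hp : p.Prime) (h : (p : ℤ) ∣ sqrtDen Q) : IsGoodAt p Q := by
  have := Fact.mk hp
  rw [isGoodAt_iff]
  refine fun h₀ ↦ apply_one_ne_zero_of_addSub_self_eq_zero _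
    (castRingHom_comp_xCoord_ne_zero hp Q) h₀ ?_
  simpa [xCoord, ZMod.natCast_eq_zero_iff] using Int.natCast_dvd_natCast.1 h

lemma isGoodAt_zero (hp : p.Prime) : IsGoodAt p (0 : RatPoint W) :=
  isGoodAt_of_dvd_sqrtDen hp (by simp [sqrtDen_zero])

lemma IsGoodAt.not_dvd_of_addSub_eq_smul (hp : p.Prime) (hQ : IsGoodAt p Q) {g : ℤ}
    {u : Fin 3 → ℤ} (h : addSub W (xCoord P) (xCoord Q) = g • u) : ¬ (p : ℤ) ∣ g := by
  have := Fact.mk hp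
  refine fun hg ↦ isGoodAt_iff.1 hQ (addSub_self_eq_zero_of_addSub_eq_zero _
    (castRingHom_comp_xCoord_ne_zero hp P) ?_)
  rw [addSub_map, h, ← forall_dvd_iff_castRingHom_comp_eq_zero]
  exact fun i ↦ hg.mul_right _

lemma IsGoodAt.add (hp : p.Prime) (hP : IsGoodAt p P) (hQ : IsGoodAt p Q) :
    IsGoodAt p (P + Q) := by
  have := Fact.mk hp
  obtain ⟨g, hg⟩ := exists_addSub_xCoord P Q
  rw [isGoodAt_iff] at hP hQ ⊢
  intro h₀
  refine (addSub_self_eq_zero_or_of_smul_symSq _ (c := (g : ZMod p))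
    (s := Int.castRingHom (ZMod p) ∘ xCoord (P - Q))
    (castRingHom_comp_xCoord_ne_zero hp (P + Q)) ?_ h₀).elim hP hQ
  rw [addSub_map, symSq_map, hg]
  ext i
  simp

lemma IsGoodAt.nsmul (hp : p.Prime) (hP : IsGoodAt p P) (n : ℕ) : IsGoodAt p (n • P) := by
  induction n with
  | zero => simpa using isGoodAt_zero hp
  | succ n ih => rw [succ_nsmul]; exact ih.add hp hP

lemma pow_dvd_sqrtDen_add (hp : p.Prime) {i : ℕ} (hP : (p : ℤ) ^ i ∣ sqrtDen P)
    (hQ : (p : ℤ) ^ i ∣ sqrtDen Q) : (p : ℤ) ^ i ∣ sqrtDen (P + Q) := by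
  have hp' := Nat.prime_iff_prime_int.1 hp
  rcases Nat.eq_zero_or_pos i with rfl | hi
  · simp
  have hpi : (p : ℤ) ∣ (p : ℤ) ^ i := dvd_pow_self _ hi.ne'
  obtain ⟨g, hg⟩ := exists_addSub_xCoord P Q
  have hgj (j : Fin 3) : addSub W (xCoord P) (xCoord Q) j =
      g * symSq (xCoord (P + Q)) (xCoord (P - Q)) j := congrFun hg j
  have hpg := (isGoodAt_of_dvd_sqrtDen hp (hpi.trans hQ)).not_dvd_of_addSub_eq_smul hp hg
  have hsq {n : ℤ} (h : (p : ℤ) ^ i ∣ n) : (p : ℤ) ^ (2 * i) ∣ n ^ 2 := by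
    rw [mul_comm, pow_mul]
    exact pow_dvd_pow_of_dvd h 2
  have hprod : (p : ℤ) ^ (2 * i) ∣ sqrtDen (P + Q) * sqrtDen (P - Q) := by
    rw [← Int.pow_dvd_pow_iff two_ne_zero, ← symSq_xCoord_two, ← pow_mul]
    refine hp'.pow_dvd_of_dvd_mul_left _ hpg ?_
    rw [pow_mul, ← hgj]
    exact sq_dvd_addSub_two (hsq hP) (hsq hQ)
  have hsum : (p : ℤ) ^ (2 * i) ∣ symSq (xCoord (P + Q)) (xCoord (P - Q)) 1 := by
    refine hp'.pow_dvd_of_dvd_mul_left _ hpg ?_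
    rw [← hgj]
    exact dvd_addSub_one (hsq hP) (hsq hQ)
  rcases pow_dvd_or_pow_dvd_of_pow_two_mul_dvd_mul hp' hprod with h | h
  · exact h
  · have h₁ : (p : ℤ) ^ (2 * i) ∣ sqrtDen (P + Q) ^ 2 * xNum (P - Q) :=
      (dvd_add_right ((hsq h).mul_left _)).1 hsum
    have h₂ := hp'.pow_dvd_of_dvd_mul_right _ (not_dvd_xNum hp (hpi.trans h)) h₁
    rwa [mul_comm, pow_mul, Int.pow_dvd_pow_iff two_ne_zero] at h₂

lemma abs_sub_eq_sqrtDen_mul_sqrtDen (hQ : ∀ p : ℕ, p.Prime → IsGoodAt p Q) :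
    |xNum P * (sqrtDen Q : ℤ) ^ 2 - xNum Q * (sqrtDen P : ℤ) ^ 2| =
      sqrtDen (P + Q) * sqrtDen (P - Q) := by
  obtain ⟨g, hg⟩ := exists_addSub_xCoord P Q
  have hg₁ : g.natAbs = 1 := by
    by_contra hne
    obtain ⟨p, hp, hpd⟩ := Nat.exists_prime_and_dvd hne
    exact (hQ p hp).not_dvd_of_addSub_eq_smul hp hg (Int.natCast_dvd.2 hpd)
  have h₂ := congrArg Int.natAbs (congrFun hg 2)
  rw [addSub_two, Pi.smul_apply, symSq_xCoord_two, smul_eq_mul, Int.natAbs_mul, hg₁, one_mul,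
    Int.natAbs_pow, Int.natAbs_pow, Int.natAbs_mul, Int.natAbs_natCast, Int.natAbs_natCast] at h₂
  rw [mul_comm (xNum Q), Int.abs_eq_natAbs]
  exact_mod_cast Nat.pow_left_injective two_ne_zero h₂

end GoodReduction

section Discriminant

variable {W : WeierstrassCurve ℤ} {p : ℕ}

lemma Δ_ne_zero_of_isElliptic_baseChange [h : (W.baseChange ℚ).IsElliptic] : W.Δ ≠ 0 := by
  have := h.isUnit.ne_zero
  rw [baseChange, map_Δ] at this
  exact fun h0 ↦ this (by simp [h0])

lemma pow_dvd_Δ (hp : p.Prime) {Q : RatPoint W} {i : ℕ}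
    (h : ∀ j, (p : ℤ) ^ i ∣ addSub W (xCoord Q) (xCoord Q) j) : (p : ℤ) ^ i ∣ W.Δ := by
  rcases Nat.eq_zero_or_pos i with rfl | hi
  · simp
  have hp' := Nat.prime_iff_prime_int.1 hp
  have hz : ¬ (p : ℤ) ∣ xCoord Q 1 ^ 7 := fun hd ↦ by
    obtain ⟨j, hj⟩ := isGoodAt_of_dvd_sqrtDen hp
      (hp'.dvd_of_dvd_pow (n := 2) (hp'.dvd_of_dvd_pow hd))
    exact hj ((dvd_pow_self _ hi.ne').trans (h j))
  refine hp'.pow_dvd_of_dvd_mul_right _ hz ?_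
  rw [Δ_mul_pow_eq]
  exact dvd_sub ((h 1).mul_right _) ((h 0).mul_right _)

lemma isGoodAt_of_not_dvd_Δ (hp : p.Prime) (h : ¬ (p : ℤ) ∣ W.Δ) (Q : RatPoint W) :
    IsGoodAt p Q := by
  by_contra hbad
  simp only [IsGoodAt, not_exists, not_not] at hbad
  exact h (by simpa using pow_dvd_Δ hp (i := 1) (by simpa using hbad))

lemma pow_dvd_sqrtDen_add_or_sub (hp : p.Prime) {P Q : RatPoint W} {i d : ℕ}
    (hΔ : ¬ (p : ℤ) ^ (d + 1) ∣ W.Δ)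
    (h : Int.castRingHom (ZMod (p ^ (2 * i + d + 1))) ∘ xCoord P =
      Int.castRingHom (ZMod (p ^ (2 * i + d + 1))) ∘ xCoord Q) :
    (p : ℤ) ^ i ∣ sqrtDen (P + Q) ∨ (p : ℤ) ^ i ∣ sqrtDen (P - Q) := by
  have hp' := Nat.prime_iff_prime_int.1 hp
  obtain ⟨g, hg⟩ := exists_addSub_xCoord P Q
  have hgj (j : Fin 3) : addSub W (xCoord P) (xCoord Q) j =
      g * symSq (xCoord (P + Q)) (xCoord (P - Q)) j := congrFun hg j
  have hdiag (j : Fin 3) : (p : ℤ) ^ (2 * i + d + 1) ∣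
      addSub W (xCoord Q) (xCoord Q) j - addSub W (xCoord P) (xCoord Q) j := by
    rw [← Nat.cast_pow, ← ZMod.intCast_eq_intCast_iff_dvd_sub]
    have := addSub_map W (Int.castRingHom (ZMod (p ^ (2 * i + d + 1)))) (xCoord P) (xCoord Q)
    rw [h, addSub_map] at this
    exact (congrFun this j).symm
  have hpg : ¬ (p : ℤ) ^ (d + 1) ∣ g := fun hd ↦ hΔ <| pow_dvd_Δ hp fun j ↦
    (dvd_sub_left (hgj j ▸ hd.mul_right _)).1 ((pow_dvd_pow _ (by omega)).trans (hdiag j))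
  have hsub : (p : ℤ) ^ (2 * i + d + 1) ∣ xCoord P 0 * xCoord Q 1 - xCoord P 1 * xCoord Q 0 := by
    rw [← Nat.cast_pow, ← ZMod.intCast_zmod_eq_zero_iff_dvd]
    have h₀ : (xCoord P 0 : ZMod (p ^ (2 * i + d + 1))) = xCoord Q 0 := congrFun h 0
    have h₁ : (xCoord P 1 : ZMod (p ^ (2 * i + d + 1))) = xCoord Q 1 := congrFun h 1
    push_cast
    rw [h₀, h₁]
    ring
  have hprod : (p : ℤ) ^ (2 * i) ∣ sqrtDen (P + Q) * sqrtDen (P - Q) := by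
    rw [← Int.pow_dvd_pow_iff two_ne_zero, ← symSq_xCoord_two, ← pow_mul]
    refine pow_dvd_right_of_not_pow_dvd_left hp' ?_ hpg
    rw [← hgj, addSub_two]
    exact (pow_dvd_pow _ (by omega)).trans (pow_mul (p : ℤ) _ 2 ▸ pow_dvd_pow_of_dvd hsub 2)
  exact pow_dvd_or_pow_dvd_of_pow_two_mul_dvd_mul hp' hprod

lemma exists_pow_dvd_sqrtDen_nsmul (hΔ : W.Δ ≠ 0) (hp : p.Prime) (P : RatPoint W) (i : ℕ) :
    ∃ n : ℕ, 0 < n ∧ (p : ℤ) ^ i ∣ sqrtDen (n • P) := by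
  have hp' := Nat.prime_iff_prime_int.1 hp
  obtain ⟨d, hd⟩ : ∃ d, ¬ (p : ℤ) ^ (d + 1) ∣ W.Δ := FiniteMultiplicity.of_prime_left hp' hΔ
  have : NeZero (p ^ (2 * i + d + 1)) := ⟨pow_ne_zero _ hp.ne_zero⟩
  obtain ⟨m, n, hmn, heq⟩ := Finite.exists_ne_map_eq_of_infinite (fun n : ℕ ↦
    Int.castRingHom (ZMod (p ^ (2 * i + d + 1))) ∘ xCoord (n • P))
  wlog hlt : m < n generalizing m n
  · exact this n m hmn.symm heq.symm (by omega)
  rcases pow_dvd_sqrtDen_add_or_sub hp hd heq.symm with h | h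
  · exact ⟨n + m, by omega, by rwa [add_nsmul]⟩
  · exact ⟨n - m, by omega, by rwa [sub_nsmul _ hlt.le, ← sub_eq_add_neg]⟩

end Discriminant

section Padic

lemma exists_units_smul_eq_of_mul_eq_mul {R ι : Type*} [CommRing R] {v w : ι → R}
    (hv : ∃ i, IsUnit (v i)) (hw : ∃ i, IsUnit (w i)) (h : ∀ i j, v i * w j = v j * w i) :
    ∃ u : Rˣ, v = u • w := by
  obtain ⟨i, hi⟩ := hv
  obtain ⟨k, b, hb⟩ := hw
  obtain ⟨a, ha⟩ : IsUnit (v k) := isUnit_of_mul_isUnit_left (h i k ▸ hi.mul ⟨b, hb⟩)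
  refine ⟨a * b⁻¹, funext fun j ↦ ?_⟩
  rw [Pi.smul_apply, Units.smul_def, smul_eq_mul, Units.val_mul, ha, mul_right_comm, h k j, ← hb,
    Units.mul_inv_cancel_right]

variable {W : WeierstrassCurve ℤ} {p : ℕ}

/-- The coprime homogeneous coordinates `(a * e : b : e ^ 3)` of `(a / e ^ 2, b / e ^ 3)`. -/
def projCoord (Q : RatPoint W) : Fin 3 → ℤ :=
  ![xNum Q * sqrtDen Q, yNum Q, (sqrtDen Q : ℤ) ^ 3]

lemma equation_projCoord (Q : RatPoint W) : W.toProjective.Equation (projCoord Q) := by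
  simp only [Projective.equation_iff, projCoord, Matrix.cons_val_zero, Matrix.cons_val_one,
    Matrix.cons_val]
  linear_combination (sqrtDen Q : ℤ) ^ 3 * yNum_equation Q

lemma not_dvd_yNum (hp : p.Prime) {Q : RatPoint W} (h : (p : ℤ) ∣ sqrtDen Q) :
    ¬ (p : ℤ) ∣ yNum Q := fun h' ↦
  (Nat.prime_iff_prime_int.1 hp).not_isUnit ((isCoprime_yNum_sqrtDen Q).isUnit_of_dvd' h' h)

variable [Fact p.Prime]

lemma nonsingular_projCoord_iff (Q : RatPoint W) :
    (W.map (Int.castRingHom (ZMod p))).toProjective.Nonsingular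
      (Int.castRingHom (ZMod p) ∘ projCoord Q) ↔ IsGoodAt p Q := by
  have hp : p.Prime := Fact.out
  have heq := (equation_projCoord Q).map (Int.castRingHom (ZMod p))
  by_cases he : (p : ℤ) ∣ sqrtDen Q
  · have he' : (sqrtDen Q : ZMod p) = 0 := by
      rw [ZMod.natCast_eq_zero_iff]; exact_mod_cast he
    have hy : (yNum Q : ZMod p) ≠ 0 := by
      rw [Ne, ZMod.intCast_zmod_eq_zero_iff_dvd]
      exact not_dvd_yNum hp he
    refine iff_of_true ?_ (isGoodAt_of_dvd_sqrtDen hp he)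
    rw [Projective.nonsingular_of_Z_eq_zero (by simp [projCoord, he'])]
    exact ⟨heq, Or.inr (by simp [projCoord, he', hy])⟩
  · have he' : (sqrtDen Q : ZMod p) ≠ 0 := fun h ↦ he (by
      exact_mod_cast (ZMod.natCast_eq_zero_iff _ _).1 h)
    have hZ : (Int.castRingHom (ZMod p) ∘ projCoord Q) 2 ≠ 0 := by simpa [projCoord] using he'
    rw [Projective.nonsingular_of_Z_ne_zero hZ,
      nonsingular_iff_addSub_self_ne_zero ((Projective.equation_of_Z_ne_zero hZ).1 heq),
      isGoodAt_iff]
    have hx : Int.castRingHom (ZMod p) ∘ xCoord Q = (sqrtDen Q : ZMod p) ^ 2 •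
        ![(Int.castRingHom (ZMod p) ∘ projCoord Q) 0 /
          (Int.castRingHom (ZMod p) ∘ projCoord Q) 2, 1] := by
      ext i
      fin_cases i
      · simp [xCoord, projCoord]
        field_simp
      · simp [xCoord]
    rw [hx, addSub_smul_smul, Ne, Ne, smul_eq_zero_iff_right (by positivity)]

lemma isUnit_intCast_padicInt_iff (k : ℤ) : IsUnit (k : ℤ_[p]) ↔ ¬ (p : ℤ) ∣ k := by
  rw [PadicInt.isUnit_iff, ← PadicInt.norm_int_lt_one_iff_dvd, not_lt]
  exact ⟨fun h ↦ h.ge, fun h ↦ le_antisymm (PadicInt.norm_le_one _) h⟩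

lemma exists_isUnit_projCoord (Q : RatPoint W) : ∃ j, IsUnit (projCoord Q j : ℤ_[p]) := by
  simp only [isUnit_intCast_padicInt_iff]
  by_cases h : (p : ℤ) ∣ sqrtDen Q
  · exact ⟨1, not_dvd_yNum Fact.out h⟩
  · exact ⟨2, fun h' ↦ h ((Nat.prime_iff_prime_int.1 Fact.out).dvd_of_dvd_pow h')⟩

lemma toPadicPoint_some {x y : ℚ} (h : (W.baseChange ℚ).toAffine.Nonsingular x y) :
    ∃ h', toPadicPoint W p (.some x y h) = .some (x : ℚ_[p]) (y : ℚ_[p]) h' := by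
  have hx : Algebra.ofId ℚ ℚ_[p] x = (x : ℚ_[p]) := eq_ratCast (algebraMap ℚ ℚ_[p]) x
  have hy : Algebra.ofId ℚ ℚ_[p] y = (y : ℚ_[p]) := eq_ratCast (algebraMap ℚ ℚ_[p]) y
  refine ⟨?_, ?_⟩
  · rw [← hx, ← hy]
    exact (W.toAffine.baseChange_nonsingular (Algebra.ofId ℚ ℚ_[p]).injective ..).2 h
  · simp only [toPadicPoint, Affine.Point.baseChange, Affine.Point.map_some, hx, hy]

lemma isPrimitiveRep_iff (Q : RatPoint W) (v : Fin 3 → ℤ_[p]) :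
    IsPrimitiveRep W p (toPadicPoint W p Q) v ↔
      ∃ u : ℤ_[p]ˣ, v = u • (Int.castRingHom ℤ_[p] ∘ projCoord Q) := by
  rcases Q with _ | ⟨x, y, h⟩
  · have : projCoord (.zero : RatPoint W) = ![0, 1, 0] := by simp [projCoord, sqrtDen, yNum]
    rw [this]
    constructor
    · rintro ⟨⟨u, hu⟩, h₀, h₂⟩
      refine ⟨u, funext fun i ↦ ?_⟩
      fin_cases i <;> simp [h₀, h₂, ← hu, Units.smul_def]
    · rintro ⟨u, rfl⟩
      exact ⟨by simp [Units.smul_def], by simp, by simp⟩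
  obtain ⟨h', hh⟩ := toPadicPoint_some (p := p) h
  rw [hh]
  set Q : RatPoint W := .some x y h
  have he : sqrtDen Q ≠ 0 := (sqrtDen_pos (Affine.Point.some_ne_zero h)).ne'
  have heℚ : (sqrtDen Q : ℚ) ≠ 0 := Nat.cast_ne_zero.2 he
  have heₚ : (sqrtDen Q : ℚ_[p]) ≠ 0 := Nat.cast_ne_zero.2 he
  have hx : (x : ℚ_[p]) * (sqrtDen Q : ℚ_[p]) ^ 2 = xNum Q := by
    exact_mod_cast congrArg (Rat.cast : ℚ → ℚ_[p])
      ((eq_div_iff (pow_ne_zero 2 heℚ)).1 (eq_xNum_div h))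
  have hy : (y : ℚ_[p]) * (sqrtDen Q : ℚ_[p]) ^ 3 = yNum Q := by
    exact_mod_cast congrArg (Rat.cast : ℚ → ℚ_[p])
      ((eq_div_iff (pow_ne_zero 3 heℚ)).1 (eq_yNum_div h))
  constructor
  · rintro ⟨hu, -, h₀, h₁⟩
    have hv (i : Fin 3) : (v i : ℚ_[p]) * sqrtDen Q ^ 3 = v 2 * projCoord Q i := by
      fin_cases i <;> simp [projCoord, h₀, h₁, ← hx, ← hy] <;> ring
    refine exists_units_smul_eq_of_mul_eq_mul hu (exists_isUnit_projCoord Q) fun i j ↦ ?_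
    refine Subtype.coe_injective (mul_right_cancel₀ (pow_ne_zero 3 heₚ) ?_)
    push_cast [Function.comp_apply, eq_intCast]
    linear_combination (projCoord Q j : ℚ_[p]) * hv i - (projCoord Q i : ℚ_[p]) * hv j
  · rintro ⟨u, rfl⟩
    obtain ⟨j, hj⟩ := exists_isUnit_projCoord (p := p) Q
    refine ⟨⟨j, u.isUnit.mul hj⟩, by simp [projCoord, Units.smul_def, he], ?_, ?_⟩
    · simp [projCoord, Units.smul_def, ← hx]
      ring
    · simp [projCoord, Units.smul_def, ← hy]
      ring

lemma mem_nonsingularReduction_iff (Q : RatPoint W) :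
    toPadicPoint W p Q ∈ nonsingularReduction W p ↔ IsGoodAt p Q := by
  have hred (u : ℤ_[p]ˣ) : (fun j ↦ PadicInt.toZMod ((u • (Int.castRingHom ℤ_[p] ∘ projCoord Q)) j))
      = PadicInt.toZMod (u : ℤ_[p]) • (Int.castRingHom (ZMod p) ∘ projCoord Q) := by
    ext j
    simp [Units.smul_def]
  simp only [nonsingularReduction, Set.mem_ofPred_eq, isPrimitiveRep_iff,
    ← nonsingular_projCoord_iff]
  constructor
  · rintro ⟨_, ⟨u, rfl⟩, hns⟩
    rw [hred] at hns
    exact (Projective.nonsingular_smul _ (u.isUnit.map PadicInt.toZMod)).1 hns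
  · refine fun hns ↦ ⟨_, ⟨1, rfl⟩, ?_⟩
    rw [hred]
    exact (Projective.nonsingular_smul _ ((1 : ℤ_[p]ˣ).isUnit.map PadicInt.toZMod)).2 hns

lemma mem_padicFiltration_iff (Q : RatPoint W) {i : ℕ} (hi : 1 ≤ i) :
    toPadicPoint W p Q ∈ padicFiltration W p i ↔ (p : ℤ) ^ i ∣ sqrtDen Q := by
  have hp : p.Prime := Fact.out
  have hdvd (n : ℤ) : (p : ℤ_[p]) ^ i ∣ n ↔ (p : ℤ) ^ i ∣ n := by
    simp [PadicInt.pow_p_dvd_int_iff]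
  have hpi : (p : ℤ) ∣ (p : ℤ) ^ i := dvd_pow_self _ (by omega)
  simp only [padicFiltration, Set.mem_ofPred_eq, mem_nonsingularReduction_iff, isPrimitiveRep_iff]
  constructor
  · rintro ⟨-, _, ⟨u, rfl⟩, h₀, h₂⟩
    simp only [Pi.smul_apply, Units.smul_def, smul_eq_mul, Units.dvd_mul_left, Function.comp_apply,
      eq_intCast, hdvd] at h₀ h₂
    have he : (p : ℤ) ∣ sqrtDen Q :=
      (Nat.prime_iff_prime_int.1 hp).dvd_of_dvd_pow (hpi.trans h₂)
    exact (Nat.prime_iff_prime_int.1 hp).pow_dvd_of_dvd_mul_left _ (not_dvd_xNum hp he) h₀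
  · refine fun h ↦ ⟨isGoodAt_of_dvd_sqrtDen hp (hpi.trans h), _, ⟨1, rfl⟩, ?_, ?_⟩
    · rw [one_smul]
      exact (hdvd _).2 (h.mul_left _)
    · rw [one_smul]
      exact (hdvd _).2 (dvd_pow h three_ne_zero)

end Padic

section MultiplicationByIntegers

open Polynomial

section Form

variable {R : Type*} [CommRing R] (W : WeierstrassCurve R)

/-- The quadratic polynomial in `t` with roots `x(P + Q)` and `x(P - Q)`, where `a = x(P)` and
`b = x(Q)`. It is symmetric in its three variables. -/
noncomputable def addSubForm (a b t : R) : R :=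
  addSub W ![a, 1] ![b, 1] 2 * t ^ 2 - addSub W ![a, 1] ![b, 1] 1 * t + addSub W ![a, 1] ![b, 1] 0

lemma addSubForm_comm (a b t : R) : addSubForm W a b t = addSubForm W b a t := by
  simp only [addSubForm, addSub, symSq_comm]

lemma addSubForm_rotate (a b t : R) : addSubForm W a b t = addSubForm W b t a := by
  simp only [addSubForm, addSub_zero, addSub_one, addSub_two, Matrix.cons_val_zero,
    Matrix.cons_val_one]
  ring

lemma addSubForm_self (a t : R) : addSubForm W a a t =
    addSub W ![a, 1] ![a, 1] 0 - addSub W ![a, 1] ![a, 1] 1 * t := by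
  simp only [addSubForm, addSub_two, Matrix.cons_val_zero, Matrix.cons_val_one]
  ring

lemma eval_Ψ₃_eq (x : R) : W.Ψ₃.eval x =
    addSub W ![x, 1] ![x, 1] 1 * x - addSub W ![x, 1] ![x, 1] 0 := by
  simp [addSub_zero, addSub_one, Ψ₃]
  ring

lemma eval_preΨ₄_mul_addSub_self_one (x : R) :
    W.preΨ₄.eval x * addSub W ![x, 1] ![x, 1] 1 = 2 * x * W.Ψ₃.eval x ^ 2 -
      addSub W ![addSub W ![x, 1] ![x, 1] 0, addSub W ![x, 1] ![x, 1] 1] ![x, 1] 1 := by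
  have b := W.b_relation
  simp [addSub_zero, addSub_one, Ψ₃, preΨ₄]
  grind

end Form

section Point

variable {F : Type*} [Field F] {W : Affine F}

lemma xRep_one_of_ne_zero {Q : W.Point} (hQ : Q ≠ 0) : Q.xRep 1 = 1 := by
  rcases Q with _ | _
  · exact (hQ rfl).elim
  · simp

lemma xRep_eq_of_ne_zero {Q : W.Point} (hQ : Q ≠ 0) : Q.xRep = ![Q.xRep 0, 1] := by
  ext i
  fin_cases i
  · rfl
  · exact xRep_one_of_ne_zero hQ

lemma evalEval_ψ₂_sq {x y : F} (h : W.Nonsingular x y) :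
    W.ψ₂.evalEval x y ^ 2 = addSub W ![x, 1] ![x, 1] 1 := by
  rw [addSub_self_one_eq_sq h.1, ψ₂, Affine.evalEval_polynomialY, Affine.negY]
  ring

variable [DecidableEq F]

lemma addSubForm_xRep {P Q : W.Point} (hP : P ≠ 0) (hQ : Q ≠ 0) (hs : P + Q ≠ 0) (hd : P - Q ≠ 0)
    (t : F) : addSubForm W (P.xRep 0) (Q.xRep 0) t =
      (P.xRep 0 - Q.xRep 0) ^ 2 * (((P + Q).xRep 0 - t) * ((P - Q).xRep 0 - t)) := by
  obtain ⟨c, h⟩ := exists_addSub_xRep P Q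
  rw [xRep_eq_of_ne_zero hP, xRep_eq_of_ne_zero hQ, xRep_eq_of_ne_zero hs,
    xRep_eq_of_ne_zero hd] at h
  have hc : c = (P.xRep 0 - Q.xRep 0) ^ 2 := by
    have h₂ := congrFun h 2
    simp [symSq, addSub_two] at h₂
    exact h₂.symm
  rw [addSubForm, h, ← hc]
  simp [symSq]
  ring

lemma addSub_self_zero_eq_mul {P : W.Point} (hP : P ≠ 0) (hs : P + P ≠ 0) :
    addSub W ![P.xRep 0, 1] ![P.xRep 0, 1] 0 =
      addSub W ![P.xRep 0, 1] ![P.xRep 0, 1] 1 * (P + P).xRep 0 := by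
  obtain ⟨c, h⟩ := exists_addSub_xRep P P
  rw [sub_self, xRep_eq_of_ne_zero hP, xRep_eq_of_ne_zero hs] at h
  simp [h, symSq]

end Point

section Multiples

variable {F : Type*} [Field F] [DecidableEq F] {W : Affine F} {x y : F} (h : W.Nonsingular x y)

/-- The `x`-coordinate of the `n`-th multiple of an affine point, with value `1` at the multiples
which are the point at infinity. -/
noncomputable def mulX (n : ℤ) : F := (n • Affine.Point.some x y h).xRep 0

/-- The denominator sequence `D` of the multiples of an affine point: `x(nP) = N n / D n ^ 2`, with
`D` determined by its first values and by `D (n + 1) * D (n - 1) = (x(P) - x(nP)) * D n ^ 2`. -/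
noncomputable def mulDen : ℕ → F
  | 0 => 0
  | 1 => 1
  | 2 => W.ψ₂.evalEval x y
  | n + 3 => mulDen (n + 2) ^ 2 * (x - mulX h (n + 2 : ℕ)) / mulDen (n + 1)

/-- The numerator sequence `N` of the multiples of an affine point: `x(nP) = N n / D n ^ 2`. -/
noncomputable def mulNum : ℕ → F
  | 0 => 1
  | n + 1 => mulX h (n + 1 : ℕ) * mulDen h (n + 1) ^ 2

/-- The `2 × 2` determinant of the fractions representing `x(mP)` and `x(nP)`. -/
noncomputable def crossDet (n m : ℕ) : F :=
  mulNum h m * mulDen h n ^ 2 - mulNum h n * mulDen h m ^ 2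

lemma mulX_neg (n : ℤ) : mulX h (-n) = mulX h n := by
  rw [mulX, neg_smul, Affine.Point.xRep_neg, mulX]

lemma mulX_one : mulX h 1 = x := by simp [mulX]

lemma mulNum_eq {n : ℕ} (hn : n ≠ 0) : mulNum h n = mulX h n * mulDen h n ^ 2 := by
  obtain ⟨k, rfl⟩ := Nat.exists_eq_succ_of_ne_zero hn
  rfl

lemma crossDet_eq {n m : ℕ} (hn : n ≠ 0) (hm : m ≠ 0) :
    crossDet h n m = (mulX h m - mulX h n) * mulDen h n ^ 2 * mulDen h m ^ 2 := by
  rw [crossDet, mulNum_eq h hn, mulNum_eq h hm]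
  ring

lemma crossDet_zero (n : ℕ) : crossDet h n 0 = mulDen h n ^ 2 := by
  simp [crossDet, mulNum, mulDen]

lemma crossDet_neg (n m : ℕ) : -crossDet h m n = crossDet h n m := by
  rw [crossDet, crossDet, neg_sub]

lemma mulDen_one : mulDen h 1 = 1 := rfl

lemma crossDet_eq_sub (n m : ℕ) : crossDet h n m =
    crossDet h n 1 * mulDen h m ^ 2 - crossDet h m 1 * mulDen h n ^ 2 := by
  simp only [crossDet, mulDen_one]
  ring

lemma mulDen_two : mulDen h 2 = W.ψ₂.evalEval x y := rfl

variable (hP : ∀ n : ℤ, n ≠ 0 → n • Affine.Point.some x y h ≠ 0)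

include hP

lemma mulX_ne {n m : ℤ} (hn : n ≠ 0) (hm : m ≠ 0) (hs : n + m ≠ 0) (hd : n - m ≠ 0) :
    mulX h n ≠ mulX h m := fun heq ↦ by
  have hx : (n • Affine.Point.some x y h).xRep = (m • Affine.Point.some x y h).xRep := by
    rw [xRep_eq_of_ne_zero (hP n hn), xRep_eq_of_ne_zero (hP m hm)]
    exact congrArg (![·, 1]) heq
  rcases Affine.Point.eq_or_eq_neg_of_xRep_eq_xRep hx with h | h
  · exact hP _ hd (by rw [sub_smul, h, sub_self])
  · exact hP _ hs (by rw [add_smul, h, neg_add_cancel])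

lemma addSubForm_mulX {n m : ℤ} (hn : n ≠ 0) (hm : m ≠ 0) (hs : n + m ≠ 0) (hd : n - m ≠ 0)
    (t : F) : addSubForm W (mulX h n) (mulX h m) t =
      (mulX h n - mulX h m) ^ 2 * ((mulX h (n + m) - t) * (mulX h (n - m) - t)) := by
  have := addSubForm_xRep (hP n hn) (hP m hm) (by rw [← add_smul]; exact hP _ hs)
    (by rw [← sub_smul]; exact hP _ hd) t
  rwa [← add_smul, ← sub_smul] at this

lemma addSubForm_mulX_one (n : ℕ) (t : F) : addSubForm W (mulX h (n + 2 : ℕ)) x t =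
    (x - mulX h (n + 2 : ℕ)) ^ 2 * ((mulX h (n + 3 : ℕ) - t) * (mulX h (n + 1 : ℕ) - t)) := by
  have := addSubForm_mulX h hP (n := (n + 2 : ℕ)) (m := 1) (by lia) one_ne_zero (by lia) (by lia) t
  rw [mulX_one, show ((n + 2 : ℕ) : ℤ) + 1 = (n + 3 : ℕ) by lia,
    show ((n + 2 : ℕ) : ℤ) - 1 = (n + 1 : ℕ) by lia] at this
  rw [this]
  ring

lemma addSub_self_zero_eq_mul_mulX_two :
    addSub W ![x, 1] ![x, 1] 0 = addSub W ![x, 1] ![x, 1] 1 * mulX h 2 := by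
  have := addSub_self_zero_eq_mul (P := .some x y h) (Affine.Point.some_ne_zero h)
    (by rw [← two_zsmul]; exact hP 2 two_ne_zero)
  rwa [← two_zsmul] at this

lemma evalEval_ψ₂_ne_zero : W.ψ₂.evalEval x y ≠ 0 := fun h₀ ↦ by
  refine hP 2 two_ne_zero ?_
  rw [two_zsmul]
  refine Affine.Point.add_self_of_Y_eq ?_
  rw [ψ₂, Affine.evalEval_polynomialY] at h₀
  rw [Affine.negY]
  linear_combination h₀

lemma mulDen_ne_zero {n : ℕ} (hn : n ≠ 0) : mulDen h n ≠ 0 := by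
  induction n using Nat.strong_induction_on with
  | _ n ih =>
    match n with
    | 0 => exact absurd rfl hn
    | 1 => simp [mulDen]
    | 2 => exact evalEval_ψ₂_ne_zero h hP
    | n + 3 =>
      have hx : x ≠ mulX h (n + 2 : ℕ) := by
        conv_lhs => rw [← mulX_one h]
        exact mulX_ne h hP one_ne_zero (by lia) (by lia) (by lia)
      rw [mulDen]
      exact div_ne_zero (mul_ne_zero (pow_ne_zero _ (ih (n + 2) (by lia) (by lia)))
        (sub_ne_zero.2 hx)) (ih (n + 1) (by lia) (by lia))

lemma mulDen_mul_mulDen (n : ℕ) : mulDen h (n + 2) * mulDen h n = crossDet h (n + 1) 1 := by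
  rw [crossDet_eq h n.succ_ne_zero one_ne_zero, Nat.cast_one, mulX_one]
  match n with
  | 0 => simp [mulDen, mulX_one]
  | n + 1 =>
    have := mulDen_ne_zero h hP n.succ_ne_zero
    simp only [mulDen]
    field_simp

lemma crossDet_mul_crossDet (n : ℕ) {m : ℕ} (hm : m ≠ 0) :
    crossDet h (n + 3) m * crossDet h (n + 1) m =
      addSubForm W (mulX h (n + 2 : ℕ)) x (mulX h m) * mulDen h (n + 2) ^ 4 * mulDen h m ^ 4 := by
  have hstep := mulDen_mul_mulDen h hP (n + 1)
  rw [addSubForm_mulX_one h hP]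
  rw [crossDet_eq h (by lia) (by lia)] at hstep ⊢
  rw [crossDet_eq h (by lia) (by lia)]
  rw [Nat.cast_one, mulX_one, mulDen_one] at hstep
  linear_combination (mulX h m - mulX h (n + 3 : ℕ)) * (mulX h m - mulX h (n + 1 : ℕ)) *
    mulDen h m ^ 4 * (mulDen h (n + 3) * mulDen h (n + 1) +
      (x - mulX h (n + 2 : ℕ)) * mulDen h (n + 2) ^ 2) * hstep

lemma addSubForm_mulX_self (n : ℕ) : addSubForm W (mulX h (n + 2 : ℕ)) x x *
    mulDen h (n + 2) ^ 2 = crossDet h (n + 2) 2 := by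
  rw [addSubForm_rotate, addSubForm_self, addSub_self_zero_eq_mul_mulX_two h hP,
    ← evalEval_ψ₂_sq h, crossDet_eq h (by lia) two_ne_zero, mulDen_two, Nat.cast_ofNat]
  ring

lemma crossDet_recurrence (k m : ℕ) :
    crossDet h (k + m + 3) (m + 1) * crossDet h (k + m + 1) (m + 1) =
      crossDet h (k + m + 2) (m + 2) * crossDet h (k + m + 2) m := by
  rw [crossDet_mul_crossDet h hP (k + m) m.succ_ne_zero]
  match m with
  | 0 =>
    rw [crossDet_zero, ← addSubForm_mulX_self h hP, Nat.cast_one, mulX_one, mulDen_one]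
    ring
  | m + 1 =>
    rw [← crossDet_neg h (k + (m + 1) + 2) (m + 1 + 2), ← crossDet_neg h (k + (m + 1) + 2) (m + 1),
      neg_mul_neg, crossDet_mul_crossDet h hP m (by lia), addSubForm_rotate, addSubForm_comm,
      addSubForm_rotate, addSubForm_comm, addSubForm_rotate]
    ring

/-- Both sides solve the recurrence `u (n + 1) m * u (n - 1) m = u n (m + 1) * u n (m - 1)`, with
the same values at `m = 0` and `m = 1`. -/
lemma mulDen_add_mul_mulDen (k m : ℕ) :
    mulDen h (k + 2 * m) * mulDen h k = crossDet h (k + m) m := by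
  induction m using Nat.twoStepInduction generalizing k with
  | zero => rw [crossDet_zero]; exact (sq _).symm
  | one => exact mulDen_mul_mulDen h hP k
  | more m ih₀ ih₁ =>
    have hne : mulDen h (k + 2 + 2 * m) * mulDen h (k + 2) ≠ 0 :=
      mul_ne_zero (mulDen_ne_zero h hP (by lia)) (mulDen_ne_zero h hP (by lia))
    refine mul_right_cancel₀ hne ?_
    calc mulDen h (k + 2 * (m + 2)) * mulDen h k * (mulDen h (k + 2 + 2 * m) * mulDen h (k + 2))
        = mulDen h (k + 2 + 2 * (m + 1)) * mulDen h (k + 2) *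
            (mulDen h (k + 2 * (m + 1)) * mulDen h k) := by ring_nf
      _ = crossDet h (k + m + 3) (m + 1) * crossDet h (k + m + 1) (m + 1) := by
        rw [ih₁, ih₁]; ring_nf
      _ = crossDet h (k + m + 2) (m + 2) * crossDet h (k + m + 2) m :=
        crossDet_recurrence h hP k m
      _ = crossDet h (k + (m + 2)) (m + 2) * (mulDen h (k + 2 + 2 * m) * mulDen h (k + 2)) := by
        rw [ih₀]; ring_nf

lemma mulDen_three : mulDen h 3 = W.Ψ₃.eval x := by
  have := mulDen_mul_mulDen h hP 1
  rw [crossDet_eq h two_ne_zero one_ne_zero, Nat.cast_one, mulX_one, mulDen_one, mulDen_two] at this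
  rw [eval_Ψ₃_eq, addSub_self_zero_eq_mul_mulX_two h hP, ← evalEval_ψ₂_sq h]
  linear_combination this

lemma addSub_mulX_two_one :
    addSub W ![mulX h 2, 1] ![x, 1] 1 = (x - mulX h 2) ^ 2 * (mulX h 3 + x) := by
  have h₀ := addSubForm_mulX_one h hP 0 0
  have h₁ := addSubForm_mulX_one h hP 0 1
  norm_num [addSubForm, mulX_one, addSub_two] at h₀ h₁
  linear_combination h₀ - h₁

lemma mulDen_four : mulDen h 4 = W.preΨ₄.eval x * W.ψ₂.evalEval x y := by
  have hψ := eval_preΨ₄_mul_addSub_self_one W x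
  have hstep := mulDen_mul_mulDen h hP 2
  rw [crossDet_eq h three_ne_zero one_ne_zero, Nat.cast_one, Nat.cast_ofNat, mulX_one, mulDen_one,
    mulDen_two, mulDen_three h hP] at hstep
  have hsmul : ![addSub W ![x, 1] ![x, 1] 0, addSub W ![x, 1] ![x, 1] 1] =
      addSub W ![x, 1] ![x, 1] 1 • ![mulX h 2, 1] := by
    simp [addSub_self_zero_eq_mul_mulX_two h hP]
  have hdbl := congrFun (addSub_smul_smul W (addSub W ![x, 1] ![x, 1] 1) 1 ![mulX h 2, 1] ![x, 1]) 1
  rw [one_smul, ← hsmul, Pi.smul_apply, addSub_mulX_two_one h hP, smul_eq_mul, mul_one] at hdbl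
  have hΨ₃ := eval_Ψ₃_eq W x
  rw [addSub_self_zero_eq_mul_mulX_two h hP] at hΨ₃
  refine mul_right_cancel₀ (evalEval_ψ₂_ne_zero h hP) ?_
  rw [hstep, mul_assoc (W.preΨ₄.eval x), ← pow_two, evalEval_ψ₂_sq h, hψ, hdbl, hΨ₃]
  ring

lemma mulDen_even (m : ℕ) : mulDen h (2 * (m + 3)) * W.ψ₂.evalEval x y =
    mulDen h (m + 2) ^ 2 * mulDen h (m + 3) * mulDen h (m + 5) -
      mulDen h (m + 1) * mulDen h (m + 3) * mulDen h (m + 4) ^ 2 := by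
  have := mulDen_add_mul_mulDen h hP 2 (m + 2)
  rw [crossDet_eq_sub, add_comm 2 (m + 2), ← mulDen_mul_mulDen h hP, ← mulDen_mul_mulDen h hP,
    mulDen_two, show 2 + 2 * (m + 2) = 2 * (m + 3) by ring] at this
  rw [this]
  ring

lemma mulDen_odd (m : ℕ) : mulDen h (2 * (m + 2) + 1) =
    mulDen h (m + 4) * mulDen h (m + 2) ^ 3 - mulDen h (m + 1) * mulDen h (m + 3) ^ 3 := by
  have := mulDen_add_mul_mulDen h hP 1 (m + 2)
  rw [crossDet_eq_sub, add_comm 1 (m + 2), ← mulDen_mul_mulDen h hP, ← mulDen_mul_mulDen h hP,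
    mulDen_one, mul_one, add_comm 1] at this
  rw [this]
  ring

lemma evalEval_ψ_natCast (n : ℕ) : (WeierstrassCurve.ψ W n).evalEval x y = mulDen h n := by
  induction n using normEDSRec with
  | zero => simp [mulDen]
  | one => simp [mulDen]
  | two => simp [mulDen]
  | three => simp [mulDen_three h hP, evalEval_C]
  | four => simp [mulDen_four h hP, evalEval_C, evalEval_mul]
  | even m h₁ h₂ h₃ h₄ h₅ =>
    have hψ := congrArg (evalEval x y) (WeierstrassCurve.ψ_even W (m + 3))
    simp only [evalEval_mul, evalEval_sub, evalEval_pow] at hψ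
    rw [show (m + 3 - 1 : ℤ) = (m + 2 : ℕ) by lia, show (m + 3 - 2 : ℤ) = (m + 1 : ℕ) by lia,
      show (m + 3 + 1 : ℤ) = (m + 4 : ℕ) by lia, show (m + 3 + 2 : ℤ) = (m + 5 : ℕ) by lia,
      show (m + 3 : ℤ) = (m + 3 : ℕ) by lia, h₁, h₂, h₃, h₄, h₅] at hψ
    exact mul_right_cancel₀ (evalEval_ψ₂_ne_zero h hP) (hψ.trans (mulDen_even h hP m).symm)
  | odd m h₁ h₂ h₃ h₄ =>
    have hψ := congrArg (evalEval x y) (WeierstrassCurve.ψ_odd W (m + 2))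
    simp only [evalEval_mul, evalEval_sub, evalEval_pow] at hψ
    rw [show (m + 2 - 1 : ℤ) = (m + 1 : ℕ) by lia, show (m + 2 + 1 : ℤ) = (m + 3 : ℕ) by lia,
      show (m + 2 + 2 : ℤ) = (m + 4 : ℕ) by lia, show (m + 2 : ℤ) = (m + 2 : ℕ) by lia,
      h₁, h₂, h₃, h₄] at hψ
    exact hψ.trans (mulDen_odd h hP m).symm

lemma evalEval_ψ_natCast_add_mul_sub {n m : ℕ} (hn : n ≠ 0) (hm : m ≠ 0) :
    (WeierstrassCurve.ψ W (n + m)).evalEval x y * (WeierstrassCurve.ψ W (n - m)).evalEval x y =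
      (mulX h m - mulX h n) * (WeierstrassCurve.ψ W n).evalEval x y ^ 2 *
        (WeierstrassCurve.ψ W m).evalEval x y ^ 2 := by
  wlog hmn : m ≤ n generalizing n m
  · have := this hm hn (le_of_not_ge hmn)
    rw [← neg_sub (m : ℤ) n, WeierstrassCurve.ψ_neg, evalEval_neg, add_comm]
    linear_combination -this
  · obtain ⟨k, rfl⟩ := exists_add_of_le hmn
    have := mulDen_add_mul_mulDen h hP k m
    rw [add_comm k m, crossDet_eq h hn hm] at this
    rw [show ((m + k : ℕ) : ℤ) + m = (k + 2 * m : ℕ) by lia,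
      show ((m + k : ℕ) : ℤ) - m = k by lia]
    simp only [evalEval_ψ_natCast h hP]
    exact this

lemma evalEval_ψ_add_mul_sub {n m : ℤ} (hn : n ≠ 0) (hm : m ≠ 0) :
    (WeierstrassCurve.ψ W (n + m)).evalEval x y * (WeierstrassCurve.ψ W (n - m)).evalEval x y =
      (mulX h m - mulX h n) * (WeierstrassCurve.ψ W n).evalEval x y ^ 2 *
        (WeierstrassCurve.ψ W m).evalEval x y ^ 2 := by
  have hneg (n : ℤ) : (WeierstrassCurve.ψ W (-n)).evalEval x y =
      -(WeierstrassCurve.ψ W n).evalEval x y := by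
    rw [WeierstrassCurve.ψ_neg, evalEval_neg]
  obtain ⟨a, rfl | rfl⟩ := n.eq_nat_or_neg <;> obtain ⟨b, rfl | rfl⟩ := m.eq_nat_or_neg <;>
    have hab := evalEval_ψ_natCast_add_mul_sub h hP (n := a) (m := b) (by lia) (by lia)
  · exact hab
  · rw [mulX_neg, hneg b, ← sub_eq_add_neg, sub_neg_eq_add]
    linear_combination hab
  · rw [mulX_neg, hneg a, show (-a + b : ℤ) = -(a - b) by ring, ← neg_add', hneg, hneg]
    linear_combination hab
  · rw [mulX_neg, mulX_neg, hneg a, hneg b, ← neg_add, ← neg_sub', hneg, hneg]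
    linear_combination hab

end Multiples

end MultiplicationByIntegers

section Recurrence

lemma eq_mul_pow_mul_pow_choose_two {G : Type*} [CommGroup G] {b : ℕ → G} {a : G}
    (h : ∀ t, b (t + 2) * b t = a * b (t + 1) ^ 2) (t : ℕ) :
    b t = b 0 * (b 1 / b 0) ^ t * a ^ t.choose 2 := by
  have hratio (t : ℕ) : b (t + 1) / b t = b 1 / b 0 * a ^ t := by
    induction t with
    | zero => simp
    | succ t ih =>
      have hstep : b (t + 2) / b (t + 1) = b (t + 1) / b t * a := by
        rw [eq_div_of_mul_eq' (h t), div_eq_iff_eq_mul, div_eq_iff_eq_mul, pow_two]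
        simp only [div_eq_mul_inv, mul_comm, mul_left_comm, mul_inv_cancel_left]
      rw [hstep, ih, mul_assoc, ← pow_succ]
  induction t with
  | zero => simp
  | succ t ih =>
    rw [← div_mul_cancel (b (t + 1)) (b t), hratio, ih, Nat.choose_succ_succ' t 1,
      Nat.choose_one_right, pow_succ (b 1 / b 0) t, pow_add]
    simp only [Nat.reduceAdd, mul_comm, mul_left_comm, mul_assoc]

lemma isUnit_intCast_zmod {q : ℕ} {z : ℤ} (hz : IsCoprime z q) : IsUnit (z : ZMod q) :=
  (ZMod.coe_int_isUnit_iff_isCoprime z q).2 hz.symm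

lemma pow_totient_modEq_one {q : ℕ} {z : ℤ} (hz : IsCoprime z q) :
    z ^ q.totient ≡ 1 [ZMOD q] := by
  have h := congrArg Units.val (ZMod.pow_totient (isUnit_intCast_zmod hz).unit)
  rw [Units.val_pow_eq_pow_val, IsUnit.unit_spec, Units.val_one] at h
  rw [← ZMod.intCast_eq_intCast_iff, Int.cast_pow, h, Int.cast_one]

lemma modEq_of_forall_isCoprime {q N : ℕ} {A : ℤ} {b : ℕ → ℤ} (hA : IsCoprime A q)
    (hb : ∀ t, IsCoprime (b t) q) (hN : q.totient ∣ N) (hAN : A ^ N.choose 2 ≡ 1 [ZMOD q])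
    (hrec : ∀ t, b (t + 2) * b t ≡ A * b (t + 1) ^ 2 [ZMOD q]) : b N ≡ b 0 [ZMOD q] := by
  simp only [← ZMod.intCast_eq_intCast_iff] at *
  let a : (ZMod q)ˣ := (isUnit_intCast_zmod hA).unit
  let c (t : ℕ) : (ZMod q)ˣ := (isUnit_intCast_zmod (hb t)).unit
  have hc (t : ℕ) : c (t + 2) * c t = a * c (t + 1) ^ 2 := by
    ext
    simpa [a, c] using hrec t
  have ha : a ^ N.choose 2 = 1 := by
    ext
    simpa [a] using hAN
  have htot : (c 1 / c 0) ^ N = 1 := by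
    obtain ⟨d, rfl⟩ := hN
    rw [pow_mul, ZMod.pow_totient, one_pow]
  have hcN := eq_mul_pow_mul_pow_choose_two hc N
  rw [htot, ha, mul_one, mul_one] at hcN
  exact congrArg Units.val hcN

/-- Dividing by the common power of `p` reduces to terms prime to `p`; since the relation is
homogeneous of degree two, the precision `p ^ (2 * k)` leaves enough for `p ^ k`. -/
lemma modEq_of_pow_dvd_iff {p : ℕ} (hp : p.Prime) {k N : ℕ} {A : ℤ} {b : ℕ → ℤ}
    (hA : ¬ (p : ℤ) ∣ A) (hN : (p ^ k).totient ∣ N) (hAN : A ^ N.choose 2 ≡ 1 [ZMOD p ^ k])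
    (hrec : ∀ t, b (t + 2) * b t ≡ A * b (t + 1) ^ 2 [ZMOD p ^ (2 * k)])
    (hval : ∀ j ≤ k, ∀ t, (p : ℤ) ^ j ∣ b t ↔ (p : ℤ) ^ j ∣ b 0) :
    b N ≡ b 0 [ZMOD p ^ k] := by
  have hp' := Nat.prime_iff_prime_int.1 hp
  by_cases hk : (p : ℤ) ^ k ∣ b 0
  · exact (Int.modEq_zero_iff_dvd.2 ((hval k le_rfl N).2 hk)).trans
      (Int.modEq_zero_iff_dvd.2 hk).symm
  have hb₀ : b 0 ≠ 0 := fun h ↦ hk (h ▸ dvd_zero _)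
  obtain ⟨c₀, hc₀, hpc₀⟩ := ((Int.finiteMultiplicity_iff (a := p)).2
    ⟨by simpa using hp.ne_one, hb₀⟩).exists_eq_pow_mul_and_not_dvd
  generalize multiplicity (p : ℤ) (b 0) = j at hc₀
  have hjk : j < k := lt_of_not_ge fun h ↦ hk (hc₀ ▸ (pow_dvd_pow _ h).mul_right _)
  choose c hc using fun t ↦ (hval j hjk.le t).2 ⟨c₀, hc₀⟩
  have hpj (i : ℕ) : (p : ℤ) ^ i ≠ 0 := pow_ne_zero i hp'.ne_zero
  have hpc (t : ℕ) : ¬ (p : ℤ) ∣ c t := fun h ↦ by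
    have := (hval (j + 1) hjk t).1 (by rw [hc, pow_succ]; exact mul_dvd_mul_left _ h)
    rw [hc₀, pow_succ, mul_dvd_mul_iff_left (hpj j)] at this
    exact hpc₀ this
  have hcop {z : ℤ} (hz : ¬ (p : ℤ) ∣ z) : IsCoprime z ((p ^ (k - j) : ℕ) : ℤ) := by
    rw [Nat.cast_pow]
    exact (hp'.coprime_iff_not_dvd.2 hz).symm.pow_right
  have hrec' (t : ℕ) : c (t + 2) * c t ≡ A * c (t + 1) ^ 2 [ZMOD (p ^ (k - j) : ℕ)] := by
    have h := (hrec t).dvd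
    rw [hc, hc, hc, show A * (p ^ j * c (t + 1)) ^ 2 - p ^ j * c (t + 2) * (p ^ j * c t) =
        (p : ℤ) ^ (2 * j) * (A * c (t + 1) ^ 2 - c (t + 2) * c t) by ring,
      show 2 * k = 2 * j + (2 * (k - j)) by lia, pow_add, mul_dvd_mul_iff_left (hpj _)] at h
    rw [Nat.cast_pow]
    exact Int.modEq_iff_dvd.2 ((pow_dvd_pow _ (by lia)).trans h)
  have hcN := modEq_of_forall_isCoprime (hcop hA) (fun t ↦ hcop (hpc t))
    ((Nat.totient_dvd_of_dvd (pow_dvd_pow p (Nat.sub_le k j))).trans hN)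
    (hAN.of_dvd (by rw [Nat.cast_pow]; exact pow_dvd_pow _ (Nat.sub_le k j))) hrec'
  have := hcN.mul_left' (c := (p : ℤ) ^ j)
  rwa [Nat.cast_pow, ← pow_add, Nat.add_sub_cancel' hjk.le, ← hc, ← hc] at this

end Recurrence

section Sign

variable {W : WeierstrassCurve ℤ} {P : RatPoint W}

lemma ne_zero_of_not_isOfFinAddOrder {A : Type*} [AddMonoid A] {a : A} (ha : ¬ IsOfFinAddOrder a) :
    a ≠ 0 := by
  rintro rfl
  exact ha IsOfFinAddOrder.zero

lemma zsmul_ne_zero_of_not_isOfFinAddOrder {A : Type*} [AddGroup A] {a : A}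
    (ha : ¬ IsOfFinAddOrder a) {n : ℤ} (hn : n ≠ 0) : n • a ≠ 0 := fun h ↦
  ha (isOfFinAddOrder_iff_zsmul_eq_zero.2 ⟨n, hn, h⟩)

lemma xRep_zero_eq_div {Q : RatPoint W} (hQ : Q ≠ 0) :
    Q.xRep 0 = xNum Q / (sqrtDen Q : ℚ) ^ 2 := by
  rcases Q with _ | ⟨x, y, h⟩
  · exact (hQ rfl).elim
  · exact eq_xNum_div h

lemma psiAt_zero : psiAt W 0 P = 0 := by
  cases P <;> simp [psiAt]

lemma psiAt_neg (n : ℤ) : psiAt W (-n) P = -psiAt W n P := by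
  cases P <;> simp [psiAt]

lemma psiAt_ne_zero (hP : ¬ IsOfFinAddOrder P) {n : ℤ} (hn : n ≠ 0) : psiAt W n P ≠ 0 := by
  rcases P with _ | ⟨x, y, h⟩
  · exact (hP IsOfFinAddOrder.zero).elim
  have hnat {m : ℕ} (hm : m ≠ 0) : psiAt W m (.some x y h) ≠ 0 := by
    have hne (n : ℤ) (hn : n ≠ 0) := zsmul_ne_zero_of_not_isOfFinAddOrder hP hn
    rw [psiAt, evalEval_ψ_natCast h hne]
    exact mulDen_ne_zero h hne hm
  obtain ⟨m, rfl | rfl⟩ := n.eq_nat_or_neg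
  · exact hnat (by lia)
  · rw [psiAt_neg, neg_ne_zero]
    exact hnat (by lia)

lemma psiAt_add_mul_psiAt_sub (hP : ¬ IsOfFinAddOrder P) {n m : ℤ} (hn : n ≠ 0) (hm : m ≠ 0) :
    psiAt W (n + m) P * psiAt W (n - m) P =
      ((m • P).xRep 0 - (n • P).xRep 0) * psiAt W n P ^ 2 * psiAt W m P ^ 2 := by
  rcases P with _ | ⟨x, y, h⟩
  · exact (hP IsOfFinAddOrder.zero).elim
  · exact evalEval_ψ_add_mul_sub h (fun n ↦ zsmul_ne_zero_of_not_isOfFinAddOrder hP) hn hm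

lemma sign_psiAt_add_mul_sign_psiAt_sub (hP : ¬ IsOfFinAddOrder P) {n m : ℤ} (hn : n ≠ 0)
    (hm : m ≠ 0) : SignType.sign (psiAt W (n + m) P) * SignType.sign (psiAt W (n - m) P) =
      SignType.sign (xNum (m • P) * (sqrtDen (n • P) : ℤ) ^ 2 -
        xNum (n • P) * (sqrtDen (m • P) : ℤ) ^ 2) := by
  have hψn := psiAt_ne_zero hP hn
  have hψm := psiAt_ne_zero hP hm
  have hPn := zsmul_ne_zero_of_not_isOfFinAddOrder hP hn
  have hPm := zsmul_ne_zero_of_not_isOfFinAddOrder hP hm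
  have hdn := sqrtDen_pos hPn
  have hdm := sqrtDen_pos hPm
  set k := xNum (m • P) * (sqrtDen (n • P) : ℤ) ^ 2 - xNum (n • P) * (sqrtDen (m • P) : ℤ) ^ 2
    with hk
  have hψ : psiAt W (n + m) P * psiAt W (n - m) P = psiAt W n P ^ 2 * psiAt W m P ^ 2 /
      ((sqrtDen (n • P) : ℚ) ^ 2 * (sqrtDen (m • P) : ℚ) ^ 2) * k := by
    rw [psiAt_add_mul_psiAt_sub hP hn hm, xRep_zero_eq_div hPn, xRep_zero_eq_div hPm, hk]
    push_cast
    field_simp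
  rw [← sign_mul, hψ, sign_mul, sign_pos (by positivity), one_mul]
  simp only [sign_apply, Int.cast_pos, Int.cast_lt_zero]

end Sign

section Eds

variable {W : WeierstrassCurve ℤ} {P : RatPoint W} {p : ℕ}

lemma pow_dvd_sqrtDen_zsmul (hp : p.Prime) {i : ℕ} (h : (p : ℤ) ^ i ∣ sqrtDen P) (n : ℤ) :
    (p : ℤ) ^ i ∣ sqrtDen (n • P) := by
  have hnat (n : ℕ) : (p : ℤ) ^ i ∣ sqrtDen (n • P) := by
    induction n with
    | zero => simp [sqrtDen_zero]
    | succ n ih => rw [succ_nsmul]; exact pow_dvd_sqrtDen_add hp ih h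
  obtain ⟨n, rfl | rfl⟩ := n.eq_nat_or_neg
  · simpa using hnat n
  · simpa [sqrtDen_neg] using hnat n

lemma sqrtDen_dvd_sqrtDen_zsmul (n : ℤ) : sqrtDen P ∣ sqrtDen (n • P) := by
  rw [Nat.dvd_iff_prime_pow_dvd_dvd]
  intro p i hp h
  exact_mod_cast pow_dvd_sqrtDen_zsmul hp (i := i) (by exact_mod_cast h) n

/-- The sequence `β` of the points `n • P`, as a sequence of integers. -/
noncomputable def eds (P : RatPoint W) (n : ℤ) : ℤ :=
  SignType.sign (psiAt W n P) * ((sqrtDen (n • P) / sqrtDen P : ℕ) : ℤ)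

lemma eds_zero : eds P 0 = 0 := by simp [eds, psiAt_zero]

lemma eds_neg (n : ℤ) : eds P (-n) = -eds P n := by
  simp [eds, psiAt_neg, sqrtDen_neg, Left.sign_neg]

lemma sqrtDen_mul_eds (n : ℤ) :
    sqrtDen P * eds P n = SignType.sign (psiAt W n P) * (sqrtDen (n • P) : ℤ) := by
  rw [eds, mul_left_comm, ← Nat.cast_mul, Nat.mul_div_cancel' (sqrtDen_dvd_sqrtDen_zsmul n)]

lemma intCast_eds (hP : ¬ IsOfFinAddOrder P) (n : ℤ) : (eds P n : ℚ) = edsb W P n := by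
  rw [edsb]
  split_ifs with hn
  · simp [hn, eds_zero]
  have hP₀ := ne_zero_of_not_isOfFinAddOrder hP
  have hpos := sqrtDen_pos hP₀
  rw [denominator_eq_sqrtDen hP₀,
    denominator_eq_sqrtDen (zsmul_ne_zero_of_not_isOfFinAddOrder hP hn),
    eq_div_iff (by positivity), mul_comm]
  have := congrArg (Int.cast : ℤ → ℚ) (sqrtDen_mul_eds (P := P) n)
  push_cast at this
  convert this using 2

lemma sign_psiAt_sq (hP : ¬ IsOfFinAddOrder P) {n : ℤ} (hn : n ≠ 0) :
    (SignType.sign (psiAt W n P) : ℤ) ^ 2 = 1 := by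
  rcases lt_or_gt_of_ne (psiAt_ne_zero hP hn) with h | h
  · simp [sign_neg h]
  · simp [sign_pos h]

lemma sqrtDen_mul_eds_sq (hP : ¬ IsOfFinAddOrder P) {n : ℤ} (hn : n ≠ 0) :
    (sqrtDen P * eds P n) ^ 2 = (sqrtDen (n • P) : ℤ) ^ 2 := by
  rw [sqrtDen_mul_eds, mul_pow, sign_psiAt_sq hP hn, one_mul]

lemma eds_add_mul_eds_sub (hP : ¬ IsOfFinAddOrder P) {m : ℤ}
    (hm : ∀ p : ℕ, p.Prime → IsGoodAt p (m • P)) (n : ℤ) :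
    eds P (n + m) * eds P (n - m) =
      xNum (m • P) * eds P n ^ 2 - xNum (n • P) * eds P m ^ 2 := by
  rcases eq_or_ne n 0 with rfl | hn
  · simp only [zero_add, zero_sub, eds_neg, eds_zero, zero_zsmul, xNum_zero]; ring
  rcases eq_or_ne m 0 with rfl | hm₀
  · simp only [add_zero, sub_zero, eds_zero, zero_zsmul, xNum_zero]; ring
  have hpos := sqrtDen_pos (ne_zero_of_not_isOfFinAddOrder hP)
  have hsq : (sqrtDen P : ℤ) ^ 2 ≠ 0 := by positivity
  have hsign := congrArg ((↑) : SignType → ℤ) (sign_psiAt_add_mul_sign_psiAt_sub hP hn hm₀)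
  rw [SignType.coe_mul] at hsign
  have habs := abs_sub_eq_sqrtDen_mul_sqrtDen (P := n • P) (Q := m • P) hm
  rw [abs_sub_comm, ← add_zsmul, sub_eq_add_neg (n • P), ← sub_zsmul] at habs
  refine mul_left_cancel₀ hsq ?_
  calc (sqrtDen P : ℤ) ^ 2 * (eds P (n + m) * eds P (n - m))
      = (sqrtDen P * eds P (n + m)) * (sqrtDen P * eds P (n - m)) := by ring
    _ = xNum (m • P) * (sqrtDen (n • P) : ℤ) ^ 2 - xNum (n • P) * (sqrtDen (m • P) : ℤ) ^ 2 := by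
        rw [← sign_mul_abs (xNum (m • P) * (sqrtDen (n • P) : ℤ) ^ 2 - _), habs, ← hsign,
          sqrtDen_mul_eds, sqrtDen_mul_eds, mul_mul_mul_comm]
    _ = (sqrtDen P : ℤ) ^ 2 * (xNum (m • P) * eds P n ^ 2 - xNum (n • P) * eds P m ^ 2) := by
        rw [← sqrtDen_mul_eds_sq hP hn, ← sqrtDen_mul_eds_sq hP hm₀]; ring

lemma pow_dvd_eds_iff (hP : ¬ IsOfFinAddOrder P) (hp : p.Prime) (j : ℕ) (n : ℤ) :
    (p : ℤ) ^ j ∣ eds P n ↔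
      (p : ℤ) ^ (j + (sqrtDen P).factorization p) ∣ sqrtDen (n • P) := by
  rcases eq_or_ne n 0 with rfl | hn
  · simp [eds_zero, sqrtDen_zero]
  have hp' := Nat.prime_iff_prime_int.1 hp
  have hsign : IsUnit (SignType.sign (psiAt W n P) : ℤ) :=
    IsUnit.of_mul_eq_one _ ((pow_two _).symm.trans (sign_psiAt_sq hP hn))
  have hsplit := Nat.ordProj_mul_ordCompl_eq_self (sqrtDen P) p
  have hcompl : ¬ (p : ℤ) ∣ ordCompl[p] (sqrtDen P) := fun h ↦
    Nat.not_dvd_ordCompl hp (sqrtDen_pos (ne_zero_of_not_isOfFinAddOrder hP)).ne'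
      (Int.natCast_dvd_natCast.1 h)
  set w := (sqrtDen P).factorization p
  set u := sqrtDen P / p ^ w
  rw [← hsign.dvd_mul_left (b := (sqrtDen (n • P) : ℤ)), ← sqrtDen_mul_eds, ← hsplit, add_comm,
    pow_add, Nat.cast_mul, Nat.cast_pow, mul_assoc,
    mul_dvd_mul_iff_left (pow_ne_zero _ hp'.ne_zero)]
  exact ⟨fun h ↦ h.mul_left _, fun h ↦ hp'.pow_dvd_of_dvd_mul_left _ hcompl h⟩

end Eds

section Orders

lemma orderModulo_mem {A : Type*} [AddCommGroup A] {S : Set A} {Q : A}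
    (h : ∃ n : ℕ, 0 < n ∧ n • Q ∈ S) : 0 < OrderModulo S Q ∧ OrderModulo S Q • Q ∈ S :=
  Nat.sInf_mem h

lemma orderModulo_eq_one {A : Type*} [AddCommGroup A] {S : Set A} {Q : A} (h : Q ∈ S) :
    OrderModulo S Q = 1 := by
  have hmem : 0 < 1 ∧ 1 • Q ∈ S := ⟨one_pos, (one_nsmul Q).symm ▸ h⟩
  exact le_antisymm (Nat.sInf_le hmem) (orderModulo_mem ⟨1, hmem⟩).1

variable {W : WeierstrassCurve ℤ} {P : RatPoint W} {p : ℕ} [hp : Fact p.Prime]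

open scoped Classical in
lemma nsmul_toPadicPoint (n : ℕ) : n • toPadicPoint W p P = toPadicPoint W p (n • P) := by
  rw [toPadicPoint, toPadicPoint, map_nsmul]

open scoped Classical in
lemma componentOrder_spec (hΔ : W.Δ ≠ 0) :
    0 < componentOrder W p P ∧ IsGoodAt p (componentOrder W p P • P) := by
  obtain ⟨n, hn, hdvd⟩ := exists_pow_dvd_sqrtDen_nsmul hΔ hp.out P 1
  have hgood := isGoodAt_of_dvd_sqrtDen hp.out (by simpa only [pow_one] using hdvd)
  have hmem := orderModulo_mem (S := nonsingularReduction W p) (Q := toPadicPoint W p P)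
    ⟨n, hn, by rwa [nsmul_toPadicPoint, mem_nonsingularReduction_iff]⟩
  rwa [nsmul_toPadicPoint, mem_nonsingularReduction_iff] at hmem

open scoped Classical in
lemma componentOrder_eq_one (h : ¬ (p : ℤ) ∣ W.Δ) : componentOrder W p P = 1 :=
  orderModulo_eq_one ((mem_nonsingularReduction_iff P).2 (isGoodAt_of_not_dvd_Δ hp.out h P))

open scoped Classical in
lemma orderModPow_spec (hΔ : W.Δ ≠ 0) {i : ℕ} (hi : 1 ≤ i) :
    0 < orderModPow W p i P ∧ (p : ℤ) ^ i ∣ sqrtDen (orderModPow W p i P • P) := by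
  obtain ⟨n, hn, hdvd⟩ := exists_pow_dvd_sqrtDen_nsmul hΔ hp.out P i
  have hmem := orderModulo_mem (S := padicFiltration W p i) (Q := toPadicPoint W p P)
    ⟨n, hn, by rwa [nsmul_toPadicPoint, mem_padicFiltration_iff _ hi]⟩
  rwa [nsmul_toPadicPoint, mem_padicFiltration_iff _ hi] at hmem

lemma le_pointVal (hP : P ≠ 0) {i : ℕ} (h : (p : ℤ) ^ i ∣ sqrtDen P) :
    i ≤ pointVal W p (toPadicPoint W p P) := by
  rcases Nat.eq_zero_or_pos i with rfl | hi
  · exact Nat.zero_le _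
  refine le_csSup ⟨sqrtDen P, fun j hj ↦ ?_⟩ ((mem_padicFiltration_iff P hi).2 h)
  rcases Nat.eq_zero_or_pos j with rfl | hj₀
  · exact Nat.zero_le _
  have hdvd : p ^ j ∣ sqrtDen P := by exact_mod_cast (mem_padicFiltration_iff P hj₀).1 hj
  exact (Nat.lt_pow_self hp.out.one_lt).le.trans (Nat.le_of_dvd (sqrtDen_pos hP) hdvd)

end Orders

section Rank

variable {W : WeierstrassCurve ℤ} {P : RatPoint W}

lemma exists_forall_componentOrder_dvd (hΔ : W.Δ ≠ 0) :
    ∃ m, 0 < m ∧ ∀ (p : ℕ) [Fact p.Prime], componentOrder W p P ∣ m := by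
  let c (p : ℕ) : ℕ := if hp : p.Prime then haveI := Fact.mk hp; componentOrder W p P else 1
  have hc (p : ℕ) [hp : Fact p.Prime] : c p = componentOrder W p P := dif_pos hp.out
  refine ⟨∏ p ∈ W.Δ.natAbs.primeFactors, c p, Finset.prod_pos fun p hp ↦ ?_, fun p hp ↦ ?_⟩
  · have := Fact.mk (Nat.prime_of_mem_primeFactors hp)
    exact hc p ▸ (componentOrder_spec hΔ).1
  · by_cases hpΔ : (p : ℤ) ∣ W.Δ
    · rw [← hc]
      exact Finset.dvd_prod_of_mem c (Nat.mem_primeFactors.2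
        ⟨hp.out, Int.natCast_dvd.1 hpΔ, Int.natAbs_ne_zero.2 hΔ⟩)
    · exact componentOrder_eq_one hpΔ ▸ one_dvd _

lemma goodMultiple_spec (hΔ : W.Δ ≠ 0) :
    0 < goodMultiple W P ∧ ∀ p : ℕ, p.Prime → IsGoodAt p (goodMultiple W P • P) := by
  obtain ⟨hpos, hdvd⟩ : 0 < goodMultiple W P ∧
      ∀ (p : ℕ) [Fact p.Prime], componentOrder W p P ∣ goodMultiple W P :=
    Nat.sInf_mem (exists_forall_componentOrder_dvd hΔ)
  refine ⟨hpos, fun p hp ↦ ?_⟩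
  have := Fact.mk hp
  obtain ⟨d, hd⟩ := hdvd p
  rw [hd, mul_nsmul]
  exact (componentOrder_spec hΔ).2.nsmul hp d

variable {p : ℕ} [hp : Fact p.Prime] {k : ℕ}

lemma edsbRank_pos (hΔ : W.Δ ≠ 0) (hk : 1 ≤ k) : 0 < edsbRank W P p k :=
  Nat.mul_pos (goodMultiple_spec hΔ).1 (orderModPow_spec hΔ (le_add_right hk)).1

lemma isGoodAt_edsbRank_nsmul (hΔ : W.Δ ≠ 0) {q : ℕ} (hq : q.Prime) :
    IsGoodAt q (edsbRank W P p k • P) := by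
  rw [edsbRank, mul_nsmul]
  exact ((goodMultiple_spec hΔ).2 q hq).nsmul hq _

lemma pow_dvd_sqrtDen_edsbRank_nsmul (hΔ : W.Δ ≠ 0) (hP : ¬ IsOfFinAddOrder P) (hk : 1 ≤ k) :
    (p : ℤ) ^ (k + (sqrtDen P).factorization p) ∣ sqrtDen (edsbRank W P p k • P) := by
  have hM := (goodMultiple_spec (P := P) hΔ).1
  have hval := le_pointVal (p := p) (P := goodMultiple W P • P)
    (fun h ↦ hP (isOfFinAddOrder_iff_nsmul_eq_zero.2 ⟨_, hM, h⟩))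
    (i := (sqrtDen P).factorization p) (by
      rw [← natCast_zsmul]
      exact pow_dvd_sqrtDen_zsmul hp.out (by exact_mod_cast Nat.ordProj_dvd (sqrtDen P) p) _)
  rw [edsbRank, mul_nsmul]
  exact (pow_dvd_pow _ (Nat.add_le_add_left hval k)).trans
    (orderModPow_spec hΔ (le_add_right hk)).2

lemma not_dvd_xNum_edsbRank_nsmul (hΔ : W.Δ ≠ 0) (hP : ¬ IsOfFinAddOrder P) (hk : 1 ≤ k) :
    ¬ (p : ℤ) ∣ xNum (edsbRank W P p k • P) :=
  not_dvd_xNum hp.out ((dvd_pow_self _ (by lia)).trans (pow_dvd_sqrtDen_edsbRank_nsmul hΔ hP hk))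

lemma pow_dvd_eds_edsbRank (hΔ : W.Δ ≠ 0) (hP : ¬ IsOfFinAddOrder P) (hk : 1 ≤ k) :
    (p : ℤ) ^ k ∣ eds P (edsbRank W P p k) := by
  rw [pow_dvd_eds_iff hP hp.out, natCast_zsmul]
  exact pow_dvd_sqrtDen_edsbRank_nsmul hΔ hP hk

lemma eds_add_mul_eds_sub_modEq (hΔ : W.Δ ≠ 0) (hP : ¬ IsOfFinAddOrder P) (hk : 1 ≤ k) (n : ℤ) :
    eds P (n + edsbRank W P p k) * eds P (n - edsbRank W P p k) ≡
      xNum (edsbRank W P p k • P) * eds P n ^ 2 [ZMOD p ^ (2 * k)] := by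
  have hgood (q : ℕ) (hq : q.Prime) : IsGoodAt q ((edsbRank W P p k : ℤ) • P) := by
    rw [natCast_zsmul]
    exact isGoodAt_edsbRank_nsmul hΔ hq
  rw [eds_add_mul_eds_sub hP hgood, natCast_zsmul, Int.modEq_iff_dvd, sub_sub_cancel, mul_comm 2 k,
    pow_mul]
  exact (pow_dvd_pow_of_dvd (pow_dvd_eds_edsbRank hΔ hP hk) 2).mul_left _

lemma pow_dvd_eds_add_edsbRank_iff (hΔ : W.Δ ≠ 0) (hP : ¬ IsOfFinAddOrder P) (hk : 1 ≤ k) {j : ℕ}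
    (hj : j ≤ k) (n : ℤ) :
    (p : ℤ) ^ j ∣ eds P (n + edsbRank W P p k) ↔ (p : ℤ) ^ j ∣ eds P n := by
  have hr : (p : ℤ) ^ (j + (sqrtDen P).factorization p) ∣
      sqrtDen ((edsbRank W P p k : ℤ) • P) := by
    rw [natCast_zsmul]
    exact (pow_dvd_pow _ (by lia)).trans (pow_dvd_sqrtDen_edsbRank_nsmul hΔ hP hk)
  rw [pow_dvd_eds_iff hP hp.out, pow_dvd_eds_iff hP hp.out, add_zsmul]
  refine ⟨fun h ↦ ?_, fun h ↦ pow_dvd_sqrtDen_add hp.out h hr⟩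
  have := pow_dvd_sqrtDen_add hp.out h (Q := -((edsbRank W P p k : ℤ) • P)) (by rwa [sqrtDen_neg])
  rwa [add_neg_cancel_right] at this

lemma eds_add_mul_edsbRank_modEq (hΔ : W.Δ ≠ 0) (hP : ¬ IsOfFinAddOrder P) (hk : 1 ≤ k) {N : ℕ}
    (hN : (p ^ k).totient ∣ N)
    (hAN : xNum (edsbRank W P p k • P) ^ N.choose 2 ≡ 1 [ZMOD p ^ k]) (n : ℤ) :
    eds P (n + N * edsbRank W P p k) ≡ eds P n [ZMOD p ^ k] := by
  have h := modEq_of_pow_dvd_iff (b := fun t ↦ eds P (n + t * edsbRank W P p k)) hp.out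
    (not_dvd_xNum_edsbRank_nsmul hΔ hP hk) hN hAN (fun t ↦ ?_) (fun j hj t ↦ ?_)
  · simpa using h
  · convert eds_add_mul_eds_sub_modEq hΔ hP hk (n + (t + 1 : ℕ) * edsbRank W P p k) using 3 <;>
      push_cast <;> ring
  · induction t with
    | zero => rfl
    | succ t ih =>
      rw [← ih, ← pow_dvd_eds_add_edsbRank_iff hΔ hP hk hj (n + t * _), Nat.cast_succ, add_mul,
        one_mul, add_assoc]

end Rank

section Period

lemma pow_choose_two_modEq_one {A q : ℤ} {s : ℕ} (h : A ^ s ≡ 1 [ZMOD q]) :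
    A ^ (2 * s).choose 2 ≡ 1 [ZMOD q] := by
  rw [Nat.choose_two_right, mul_assoc, Nat.mul_div_cancel_left _ two_pos, pow_mul]
  simpa only [one_pow] using h.pow (2 * s - 1)

lemma pow_mul_prime_pow_modEq_one {p : ℕ} {A : ℤ} {s : ℕ} (h : A ^ s ≡ 1 [ZMOD p]) (k : ℕ) :
    A ^ (s * p ^ k) ≡ 1 [ZMOD p ^ (k + 1)] := by
  have := dvd_sub_pow_of_dvd_sub h.symm.dvd k
  rw [one_pow, ← pow_mul] at this
  exact (Int.modEq_iff_dvd.2 this).symm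

lemma apply_modEq_of_modEq {f : ℤ → ℤ} {q T : ℤ} (h : ∀ n, f (n + T) ≡ f n [ZMOD q]) {m n : ℤ}
    (hmn : m ≡ n [ZMOD T]) : f m ≡ f n [ZMOD q] := by
  have hper : Function.Periodic (fun n ↦ f n % q) T := h
  obtain ⟨c, hc⟩ := hmn.dvd
  rw [show n = m + c * T by linear_combination hc]
  exact (hper.int_mul c m).symm

variable {p : ℕ} [hp : Fact p.Prime]

lemma legendreSym_eq_one_of_mul_sq {A y : ℤ} (h : legendreSym p (A * y ^ 2) = 1) :
    legendreSym p A = 1 := by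
  have hy : (y : ZMod p) ≠ 0 := fun hy ↦ by
    rw [(legendreSym.eq_zero_iff p _).2 (by push_cast; rw [hy]; ring)] at h
    exact zero_ne_one h
  rwa [legendreSym.mul, legendreSym.sq_one' p hy, mul_one] at h

lemma pow_half_modEq_one {A : ℤ} (h : legendreSym p A = 1) : A ^ (p / 2) ≡ 1 [ZMOD p] := by
  have heuler := legendreSym.eq_pow p A
  rw [h] at heuler
  rw [← ZMod.intCast_eq_intCast_iff, Int.cast_pow, ← heuler]

lemma two_mul_half_mul_pow (hp₂ : p ≠ 2) (k : ℕ) :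
    2 * (p / 2 * p ^ (k - 1)) = (p - 1) * p ^ (k - 1) := by
  have := hp.out.eq_two_or_odd.resolve_left hp₂
  rw [← mul_assoc, show 2 * (p / 2) = p - 1 by lia]

variable {W : WeierstrassCurve ℤ} {P : RatPoint W} {k : ℕ}

lemma legendreSym_xNum_edsbRank_nsmul (hΔ : W.Δ ≠ 0) (hP : ¬ IsOfFinAddOrder P) (hk : 1 ≤ k)
    {n : ℤ} (h : legendreSym p
      (eds P (n + edsbRank W P p k) * eds P (n - edsbRank W P p k)) = 1) :
    legendreSym p (xNum (edsbRank W P p k • P)) = 1 := by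
  have hmod := (eds_add_mul_eds_sub_modEq (p := p) hΔ hP hk n).of_dvd (dvd_pow_self _ (by lia))
  rw [legendreSym.mod, hmod, ← legendreSym.mod] at h
  exact legendreSym_eq_one_of_mul_sq h

lemma edsbPeriod_pos (hΔ : W.Δ ≠ 0) (hk : 1 ≤ k) (β : ℤ → ℤ) : 0 < edsbPeriod W P β p k := by
  have hp₁ : 0 < p - 1 := Nat.sub_pos_of_lt hp.out.one_lt
  have hpk : 0 < p ^ (k - 1) := pow_pos hp.out.pos _
  have hr := edsbRank_pos (P := P) (p := p) hΔ hk
  rw [edsbPeriod]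
  split_ifs <;> positivity

lemma eds_add_edsbPeriod_modEq (hΔ : W.Δ ≠ 0) (hP : ¬ IsOfFinAddOrder P) (hk : 1 ≤ k) (n : ℤ) :
    eds P (n + edsbPeriod W P (eds P) p k) ≡ eds P n [ZMOD p ^ k] := by
  have htot : (p ^ k).totient = (p - 1) * p ^ (k - 1) := by
    rw [Nat.totient_prime_pow hp.out hk, mul_comm]
  rw [edsbPeriod]
  split_ifs with h
  · have hA := pow_half_modEq_one (legendreSym_xNum_edsbRank_nsmul hΔ hP hk h.2)
    have hpow := pow_choose_two_modEq_one (pow_mul_prime_pow_modEq_one hA (k - 1))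
    rw [two_mul_half_mul_pow h.1, Nat.sub_add_cancel hk] at hpow
    rw [Nat.cast_mul]
    exact eds_add_mul_edsbRank_modEq hΔ hP hk htot.dvd hpow n
  · have hcop : IsCoprime (xNum (edsbRank W P p k • P)) ((p ^ k : ℕ) : ℤ) := by
      rw [Nat.cast_pow]
      exact ((Nat.prime_iff_prime_int.1 hp.out).coprime_iff_not_dvd.2
        (not_dvd_xNum_edsbRank_nsmul hΔ hP hk)).symm.pow_right
    have hpow := pow_choose_two_modEq_one (pow_totient_modEq_one hcop)
    rw [mul_assoc 2, ← htot, Nat.cast_mul]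
    rw [Nat.cast_pow] at hpow
    exact eds_add_mul_edsbRank_modEq hΔ hP hk (dvd_mul_left _ _) hpow n

lemma exists_period_of_prime_pow {f : ℤ → ℤ}
    (h : ∀ p k : ℕ, p.Prime → 1 ≤ k → ∃ T : ℕ, 0 < T ∧ ∀ m n : ℤ, m ≡ n [ZMOD T] →
      f m ≡ f n [ZMOD p ^ k]) (N : ℕ) (hN : 1 ≤ N) :
    ∃ T : ℕ, 0 < T ∧ ∀ m n : ℤ, m ≡ n [ZMOD T] → f m ≡ f n [ZMOD N] := by
  induction N using Nat.recOnPrimeCoprime with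
  | zero => lia
  | prime_pow p k hp =>
    rcases Nat.eq_zero_or_pos k with rfl | hk
    · exact ⟨1, one_pos, fun m n _ ↦ by simpa only [pow_zero, Nat.cast_one] using Int.modEq_one⟩
    · simpa only [Nat.cast_pow] using h p k hp hk
  | coprime a b ha hb hab iha ihb =>
    obtain ⟨S, hS, hSf⟩ := iha (by lia)
    obtain ⟨T, hT, hTf⟩ := ihb (by lia)
    refine ⟨S * T, Nat.mul_pos hS hT, fun m n hmn ↦ ?_⟩
    rw [Nat.cast_mul] at hmn ⊢
    rw [← Int.modEq_and_modEq_iff_modEq_mul (by simpa only [Int.natAbs_natCast] using hab)]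
    exact ⟨hSf m n (hmn.of_mul_right _), hTf m n (hmn.of_mul_left _)⟩

end Period

end DenominatorSequence

open DenominatorSequence

theorem proposition3p5 (W : WeierstrassCurve ℤ) [(W.baseChange ℚ).IsElliptic]
    (P : (W.baseChange ℚ).toAffine.Point) (hP : ¬ IsOfFinAddOrder P) :
    ∃ β : ℤ → ℤ, (∀ n : ℤ, (β n : ℚ) = WeierstrassCurve.edsb W P n) ∧
      (∀ (p : ℕ) [Fact p.Prime] (k : ℕ), 1 ≤ k →
        0 < WeierstrassCurve.edsbPeriod W P β p k ∧
        ∀ m n : ℤ, m ≡ n [ZMOD (WeierstrassCurve.edsbPeriod W P β p k : ℤ)] →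
          β m ≡ β n [ZMOD (p : ℤ) ^ k]) ∧
      (∀ N : ℕ, 1 ≤ N → ∃ T : ℕ, 0 < T ∧ ∀ m n : ℤ, m ≡ n [ZMOD (T : ℤ)] →
        β m ≡ β n [ZMOD (N : ℤ)]) := by
  have hΔ : W.Δ ≠ 0 := Δ_ne_zero_of_isElliptic_baseChange
  have hprime (p : ℕ) [Fact p.Prime] (k : ℕ) (hk : 1 ≤ k) :
      0 < WeierstrassCurve.edsbPeriod W P (eds P) p k ∧
        ∀ m n : ℤ, m ≡ n [ZMOD WeierstrassCurve.edsbPeriod W P (eds P) p k] →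
          eds P m ≡ eds P n [ZMOD p ^ k] :=
    ⟨edsbPeriod_pos hΔ hk _,
      fun _ _ ↦ apply_modEq_of_modEq (eds_add_edsbPeriod_modEq hΔ hP hk)⟩
  refine ⟨eds P, intCast_eds hP, hprime, exists_period_of_prime_pow fun p k hp hk ↦ ?_⟩
  have := Fact.mk hp
  exact ⟨_, hprime p k hk⟩
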